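/- Let $\mathbb K$ be $\mathbb R$ or $\mathbb C$, let $X$ be a $\mathbb K$-Banach space and let $\mathcal L(X)$ be the Banach space of bounded linear operators on $X$. Let $\mathcal I(X)=\{Q\in\mathcal L(X)\setminus\{0,I\}: Q^2=Q\}$, and let $\mathscr G(X)$ be the set of non-zero proper complemented subspaces of $X$. For $E,F\in\mathscr G(X)$ that are complements of each other, let $Q_E^F\in\mathcal I(X)$ be the idempotent with range $E$ and kernel $F$. Put $\mathfrak C_F=\{E\in\mathscr G(X): E \text{ is a complement of } F\}$ and $\mathcal L^F(X,F)=\{T\in\mathcal L(X): T(X)\subseteq F,\ T(F)=\{0\}\}$. Let $\mathscr G(X)$ carry the topology and charts given, for all complementary $E_0,F_0\in\mathscr G(X)$, by the inverse $p_{E_0,F_0}:\mathfrak C_{F_0}\to\mathcal L(E_0,F_0)$ of the bijection $T\mapsto (I+T)(E_0)$ (the Douady Grassmannian), and let $\kappa:\mathcal I(X)\to\mathscr G(X)$, $\kappa(Q)=Q(X)$. A non-empty subset $A$ of a Banach space is an affine-Banach subspace if $A-a_0$ is a closed linear subspace for $a_0\in A$; the set $\mathcal A(A,B)$ of continuous affine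 maps between two such subspaces carries the analytic structure defined by the (equivalent, complete) norms $\|T^{a_0}\|+\|T(a_0)\|$, where $T^{a_0}$ is the linear part of $T$. A continuous analytic surjection $\kappa:\Upsilon\to\Omega$ between Hausdorff $\mathbb K$-analytic Banach manifolds is a locally trivial $\mathbb K$-analytic affine-Banach bundle if (B1) each fiber $\Upsilon_\omega=\kappa^{-1}(\omega)$ is homeomorphic to an affine-Banach subspace of a Banach space, whose structure it is given; (B2) for each $\omega_0\in\Omega$ there are an open neighborhood $V_{\omega_0}$ of $\omega_0$ and a bi-analytic bijection $\Theta_{\omega_0}:V_{\omega_0}\times\Upsilon_{\omega_0}\to\kappa^{-1}(V_{\omega_0})$ that restricts, for each $\omega\in V_{\omega_0}$, to an affine map of $\{\omega\}\times\Upsilon_{\omega_0}$ onto $\Upsilon_\omega$; (B3) whenever $V_{\omega_1}\cap V_{\omega_2}\neq\emptyset$, the map $\varphi:V_{\omega_1}\cap V_{\omega_2}\to\mathcal A(\Upsilon_{\omega_1},\Upsilon_{\omega_2})$, $\varphi(\omega)(x)=\Pi_2(\Theta_{\omega_2}^{-1}(\Theta_{\omega_1}(\omega,x)))$, where $\Pi_2$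 is the projection onto the second coordinate, is analytic. Then: (1) $\mathscr G(X)$ is a Hausdorff $\mathbb K$-analytic Banach manifold, $\mathcal I(X)$ is a $\mathbb K$-analytic Banach submanifold of $\mathcal L(X)$, and, with the induced submanifold structure on $\mathcal I(X)$, $\kappa:\mathcal I(X)\to\mathscr G(X)$ is a locally trivial $\mathbb K$-analytic affine-Banach bundle, such that for every $E\in\mathscr G(X)$ the fiber $\kappa^{-1}(E)$ is an affine-Banach subspace of $\mathcal L(X)$ and its affine-Banach structure is the one induced from $\mathcal L(X)$. (2) For all complementary $E_0,F_0\in\mathscr G(X)$, the map $\mu_{E_0,F_0}:\kappa^{-1}(\mathfrak C_{F_0})\to\mathcal L^{F_0}(X,F_0)\times\mathcal L^{E_0}(X,E_0)$, $$\mu_{E_0,F_0}(Q)=\big(Q_{Q(X)}^{F_0}-Q_{E_0}^{F_0},\ Q_{E_0}^{F_0}\,Q\,Q_{F_0}^{E_0}\big),$$ is a bijection with inverse $$\mu_{E_0,F_0}^{-1}(R,S)=S-SR+Q_{E_0}^{F_0}+RS-RSR+R,$$ and these maps form an analytic atlas of $\mathcal I(X)$ (compatible with the norm topology) that defines the analytic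 structure induced from $\mathcal L(X)$. -/

import Mathlib

open Set Topology

noncomputable section

universe u𝕜 uM uN uι uι' uE uE' uX uΩ uΥ uY

/-! ### Analytic Banach manifolds whose charts take values in varying Banach spaces -/

/-- A family of charts on a set `M`, each a bijection from a subset of `M` onto a subset of some
`𝕜`-Banach space, which may vary from chart to chart. -/
structure ChartFamily (𝕜 : Type u𝕜) [NontriviallyNormedField 𝕜] (M : Type uM) where
  ι : Type uι
  Model : ι → Type uE
  [normed : ∀ i, NormedAddCommGroup (Model i)]
  [space : ∀ i, NormedSpace 𝕜 (Model i)]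
  [complete : ∀ i, CompleteSpace (Model i)]
  chart : ∀ i, PartialEquiv M (Model i)

namespace ChartFamily

attribute [instance] ChartFamily.normed ChartFamily.space ChartFamily.complete

variable {𝕜 : Type u𝕜} [NontriviallyNormedField 𝕜] {M : Type uM} {N : Type uN}

/-- The topology defined by a family of charts: `U` is open iff its image under every chart is
open, i.e. iff every `{t ∈ target | φ⁻¹ t ∈ U}` is (relatively) open in the target of `φ`. -/
abbrev topology (A : ChartFamily.{u𝕜, uM, uι, uE} 𝕜 M) : TopologicalSpace M :=
  ⨆ i, TopologicalSpace.coinduced (fun t : (A.chart i).target => (A.chart i).symm t) inferInstance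

/-- The charts form a `𝕜`-analytic atlas, compatible with the given topology of `M`. -/
structure IsAnalyticAtlas [TopologicalSpace M] (A : ChartFamily.{u𝕜, uM, uι, uE} 𝕜 M) :
    Prop where
  covers : ∀ x, ∃ i, x ∈ (A.chart i).source
  isOpen_source : ∀ i, IsOpen (A.chart i).source
  isOpen_target : ∀ i, IsOpen (A.chart i).target
  continuousOn : ∀ i, ContinuousOn (A.chart i) (A.chart i).source
  continuousOn_symm : ∀ i, ContinuousOn (A.chart i).symm (A.chart i).target
  analytic_transition : ∀ i j,
    AnalyticOnNhd 𝕜 (A.chart j ∘ (A.chart i).symm) ((A.chart i).symm.trans (A.chart j)).source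

/-- `f` is `𝕜`-analytic on the (open) set `s`, with respect to the atlases `A` and `B`. -/
def IsAnalyticOn [TopologicalSpace M] [TopologicalSpace N]
    (A : ChartFamily.{u𝕜, uM, uι, uE} 𝕜 M) (B : ChartFamily.{u𝕜, uN, uι', uE'} 𝕜 N)
    (f : M → N) (s : Set M) : Prop :=
  ContinuousOn f s ∧ ∀ x ∈ s, ∀ i j, x ∈ (A.chart i).source → f x ∈ (B.chart j).source →
    AnalyticAt 𝕜 (B.chart j ∘ f ∘ (A.chart i).symm) (A.chart i x)

/-- Two atlases define the same analytic structure: the identity is analytic in both directions. -/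
def SameStructure [TopologicalSpace M] (A : ChartFamily.{u𝕜, uM, uι, uE} 𝕜 M)
    (B : ChartFamily.{u𝕜, uM, uι', uE'} 𝕜 M) : Prop :=
  A.IsAnalyticOn B id univ ∧ B.IsAnalyticOn A id univ

/-- The product of two families of charts. -/
def prod (A : ChartFamily.{u𝕜, uM, uι, uE} 𝕜 M) (B : ChartFamily.{u𝕜, uN, uι', uE'} 𝕜 N) :
    ChartFamily 𝕜 (M × N) where
  ι := A.ι × B.ι
  Model i := A.Model i.1 × B.Model i.2
  chart i := (A.chart i.1).prod (B.chart i.2)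

end ChartFamily

/-! ### The submanifold structure on a subset of a Banach space -/

section Submanifold

variable (𝕜 : Type u𝕜) [NontriviallyNormedField 𝕜] {Y : Type uY} [NormedAddCommGroup Y]
  [NormedSpace 𝕜 Y] [CompleteSpace Y]

/-- A slice chart of `Y` for the subset `S` around the point `pt` of `S`: a bi-analytic
homeomorphism `toHomeo` between open subsets of `Y`, the first of which contains `pt`, that carries
the part of `S` in its source onto the part of the complemented subspace `slice` in its target. -/
structure SliceChart (S : Set Y) where
  pt : S
  toHomeo : OpenPartialHomeomorph Y Y
  slice : Submodule 𝕜 Y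
  pt_mem : (pt : Y) ∈ toHomeo.source
  analytic : AnalyticOnNhd 𝕜 toHomeo toHomeo.source
  analytic_symm : AnalyticOnNhd 𝕜 toHomeo.symm toHomeo.target
  complemented : slice.ClosedComplemented
  mem_iff : ∀ y ∈ toHomeo.source, y ∈ S ↔ toHomeo y ∈ slice

/-- A slice chart restricts to a chart of `S` with values in the complemented subspace. -/
def SliceChart.restrict {S : Set Y} (c : SliceChart 𝕜 S) : PartialEquiv S c.slice where
  toFun s := by
    classical exact if h : c.toHomeo s ∈ c.slice then ⟨c.toHomeo s, h⟩ else 0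
  invFun t := by
    classical exact if h : c.toHomeo.symm t ∈ S then ⟨c.toHomeo.symm t, h⟩ else c.pt
  source := {s | (s : Y) ∈ c.toHomeo.source}
  target := {t | (t : Y) ∈ c.toHomeo.target}
  map_source' := by
    intro s hs
    have h := (c.mem_iff s hs).1 s.2
    simpa [h] using c.toHomeo.map_source hs
  map_target' := by
    intro t ht
    have hs := c.toHomeo.map_target ht
    have h : c.toHomeo.symm t ∈ S := by
      rw [c.mem_iff _ hs, c.toHomeo.right_inv ht]
      exact t.2
    simpa [h] using hs
  left_inv' := by
    intro s hs
    have h := (c.mem_iff s hs).1 s.2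
    have hl := c.toHomeo.left_inv hs
    simp [h, hl]
  right_inv' := by
    intro t ht
    have hs := c.toHomeo.map_target ht
    have hr := c.toHomeo.right_inv ht
    have h : c.toHomeo.symm t ∈ S := by
      rw [c.mem_iff _ hs, hr]
      exact t.2
    simp [h, hr]

/-- The charts of `S` obtained by restricting all slice charts. `S` is an analytic Banach
submanifold of `Y` iff these are an analytic atlas of `S` with its subspace topology; the analytic
structure which they define is the submanifold structure induced from `Y`. -/
def submanifoldCharts (S : Set Y) : ChartFamily.{u𝕜, uY, uY, uY} 𝕜 S where
  ι := SliceChart 𝕜 S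
  Model c := c.slice
  complete c := c.complemented.isClosed.completeSpace_coe
  chart c := c.restrict

end Submanifold

/-! ### Affine-Banach subspaces and the continuous affine maps between them -/

/-- An affine-Banach subspace of `Y`: a non-empty affine subspace whose direction (the set
`A - a₀`, for any `a₀ ∈ A`) is a closed linear subspace. -/
structure AffineBanachSubspace (𝕜 : Type u𝕜) [NontriviallyNormedField 𝕜] (Y : Type uY)
    [NormedAddCommGroup Y] [NormedSpace 𝕜 Y] where
  space : AffineSubspace 𝕜 Y
  nonempty : Nonempty space
  isClosed_direction : IsClosed (space.direction : Set Y)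

namespace AffineBanachSubspace

attribute [instance] AffineBanachSubspace.nonempty

variable {𝕜 : Type u𝕜} [NontriviallyNormedField 𝕜] {Y : Type uY} [NormedAddCommGroup Y]
  [NormedSpace 𝕜 Y] [CompleteSpace Y] {Z : Type uE} [NormedAddCommGroup Z]
  [NormedSpace 𝕜 Z] [CompleteSpace Z]

instance (A : AffineBanachSubspace 𝕜 Y) : CompleteSpace A.space.direction :=
  A.isClosed_direction.completeSpace_coe

/-- The analytic structure of an affine-Banach subspace, given by the global charts
`a ↦ a - a₀`. -/
def charts (A : AffineBanachSubspace 𝕜 Y) : ChartFamily.{u𝕜, uY, uY, uY} 𝕜 A.space where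
  ι := A.space
  Model _ := A.space.direction
  chart a₀ := (Equiv.vaddConst a₀).symm.toPartialEquiv

/-- The identification of a continuous affine map `T : A → B` with its continuous linear part and
the displacement of `T a₀` from `b₀`. -/
def mapsEquiv (A : AffineBanachSubspace 𝕜 Y) (B : AffineBanachSubspace 𝕜 Z)
    (a₀ : A.space) (b₀ : B.space) :
    (A.space →ᴬ[𝕜] B.space) ≃ (A.space.direction →L[𝕜] B.space.direction) × B.space.direction where
  toFun T := (T.contLinear, T a₀ -ᵥ b₀)
  invFun p :=
    { toFun := fun a => p.1 (a -ᵥ a₀) +ᵥ (p.2 +ᵥ b₀)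
      linear := p.1
      map_vadd' := by
        intro a v
        simp [vadd_vsub_assoc, vadd_vadd, add_assoc]
      cont := by fun_prop }
  left_inv T := by
    refine ContinuousAffineMap.ext fun a => ?_
    change T.contLinear (a -ᵥ a₀) +ᵥ ((T a₀ -ᵥ b₀) +ᵥ b₀) = T a
    rw [vsub_vadd, ContinuousAffineMap.contLinear_map_vsub, vsub_vadd]
  right_inv p := by
    refine Prod.ext rfl ?_
    change (p.1 (a₀ -ᵥ a₀) +ᵥ (p.2 +ᵥ b₀)) -ᵥ b₀ = p.2
    simp

/-- The analytic structure on the set of continuous affine maps from `A` to `B`, which comes from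
the complete norms `T ↦ ‖linear part of T‖ + ‖T a₀‖`. -/
def mapsCharts (A : AffineBanachSubspace 𝕜 Y) (B : AffineBanachSubspace 𝕜 Z) :
    ChartFamily.{u𝕜, max uY uE, max uY uE, max uY uE} 𝕜 (A.space →ᴬ[𝕜] B.space) where
  ι := A.space × B.space
  Model _ := (A.space.direction →L[𝕜] B.space.direction) × B.space.direction
  chart p := (mapsEquiv A B p.1 p.2).toPartialEquiv

instance (A : AffineBanachSubspace 𝕜 Y) (B : AffineBanachSubspace 𝕜 Z) :
    TopologicalSpace (A.space →ᴬ[𝕜] B.space) :=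
  (mapsCharts A B).topology

end AffineBanachSubspace

/-! ### Locally trivial analytic affine-Banach bundles -/

/-- `κ : Υ → Ω` is a locally trivial `𝕜`-analytic affine-Banach bundle, where `Υ` and `Ω` carry
the analytic structures given by `AΥ` and `AΩ`, and the fiber over `ω` carries the affine-Banach
structure given by its homeomorphism `e ω` onto the affine-Banach subspace `fib ω` of `Y ω`. -/
structure IsAnalyticAffineBanachBundle {𝕜 : Type u𝕜} [NontriviallyNormedField 𝕜]
    {Υ : Type uΥ} [TopologicalSpace Υ] {Ω : Type uΩ} [TopologicalSpace Ω]
    (AΥ : ChartFamily.{u𝕜, uΥ, uι, uE} 𝕜 Υ) (AΩ : ChartFamily.{u𝕜, uΩ, uι', uE'} 𝕜 Ω)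
    (κ : Υ → Ω) {Y : Ω → Type uY} [∀ ω, NormedAddCommGroup (Y ω)] [∀ ω, NormedSpace 𝕜 (Y ω)]
    [∀ ω, CompleteSpace (Y ω)] (fib : ∀ ω, AffineBanachSubspace 𝕜 (Y ω))
    (e : ∀ ω, (κ ⁻¹' {ω} : Set Υ) ≃ₜ (fib ω).space) : Prop where
  t2_total : T2Space Υ
  t2_base : T2Space Ω
  total_atlas : AΥ.IsAnalyticAtlas
  base_atlas : AΩ.IsAnalyticAtlas
  continuous_proj : Continuous κ
  surjective_proj : Function.Surjective κ
  analytic_proj : AΥ.IsAnalyticOn AΩ κ univ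
  /-- There are neighborhoods `V ω₀` and trivializations `Θ ω₀ : V ω₀ × Υ_ω₀ → κ⁻¹ (V ω₀)` that
  are bi-analytic bijections, fiberwise affine, and have analytic transition maps. -/
  locally_trivial : ∃ (V : Ω → Set Ω) (Θ : ∀ ω₀, PartialEquiv (Ω × (fib ω₀).space) Υ),
    (∀ ω₀, IsOpen (V ω₀) ∧ ω₀ ∈ V ω₀ ∧
      (Θ ω₀).source = V ω₀ ×ˢ univ ∧ (Θ ω₀).target = κ ⁻¹' V ω₀ ∧
      (AΩ.prod (fib ω₀).charts).IsAnalyticOn AΥ (Θ ω₀) (Θ ω₀).source ∧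
      AΥ.IsAnalyticOn (AΩ.prod (fib ω₀).charts) (Θ ω₀).symm (Θ ω₀).target ∧
      ∀ ω ∈ V ω₀, ∃ a : (fib ω₀).space →ᵃ[𝕜] (fib ω).space, Function.Surjective a ∧
        ∀ x, Θ ω₀ (ω, x) = (e ω).symm (a x)) ∧
    ∀ ω₁ ω₂, (V ω₁ ∩ V ω₂).Nonempty →
      ∃ φ : Ω → ((fib ω₁).space →ᴬ[𝕜] (fib ω₂).space),
        (∀ ω ∈ V ω₁ ∩ V ω₂, ∀ x, φ ω x = ((Θ ω₂).symm (Θ ω₁ (ω, x))).2) ∧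
        AΩ.IsAnalyticOn (AffineBanachSubspace.mapsCharts (fib ω₁) (fib ω₂)) φ (V ω₁ ∩ V ω₂)

/-! ### The Grassmann manifold -/

section Grassmannian

variable (𝕜 : Type u𝕜) [RCLike 𝕜] (X : Type uX) [NormedAddCommGroup X] [NormedSpace 𝕜 X]

/-- The set of all non-zero proper complemented subspaces of `X`. -/
def Grassmannian : Type uX :=
  {E : Submodule 𝕜 X // E ≠ ⊥ ∧ E ≠ ⊤ ∧ E.ClosedComplemented}

variable {𝕜 X}

/-- `F` is a (topological) complement of `E`. -/
def Grassmannian.Compl (E F : Grassmannian 𝕜 X) : Prop :=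
  Submodule.IsTopCompl E.1 F.1

/-- The set of all complements of `F`. -/
def Grassmannian.compls (F : Grassmannian 𝕜 X) : Set (Grassmannian 𝕜 X) :=
  {E | Grassmannian.Compl E F}

/-- The idempotent with range `E` and kernel `F`. -/
def Grassmannian.idem (E F : Grassmannian 𝕜 X) (h : Grassmannian.Compl E F) : X →L[𝕜] X :=
  Submodule.projectionL E.1 F.1 h

/-- The subspace `(I + T)(E)`, for `T : E → F`. -/
def graphSubspace {E F : Submodule 𝕜 X} (T : E →L[𝕜] F) : Submodule 𝕜 X :=
  LinearMap.range (E.subtype + F.subtype ∘ₗ T.toLinearMap)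

theorem isTopCompl_graphSubspace {E F : Submodule 𝕜 X} (h : Submodule.IsTopCompl E F)
    (T : E →L[𝕜] F) : Submodule.IsTopCompl (graphSubspace T) F := by
  have key := ContinuousLinearMap.isTopCompl_range_ker_of_leftInverse
    (E.subtypeL + F.subtypeL ∘L T) (E.projectionOntoL F h) (by
      intro x
      simp)
  rw [Submodule.ker_projectionOntoL] at key
  exact key

theorem Grassmannian.mem_of_isTopCompl {E F : Submodule 𝕜 X} (h : Submodule.IsTopCompl E F)
    (hb : F ≠ ⊥) (ht : F ≠ ⊤) : E ≠ ⊥ ∧ E ≠ ⊤ ∧ E.ClosedComplemented := by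
  refine ⟨?_, ?_, h.closedComplemented⟩
  · rintro rfl
    exact ht (by simpa using h.isCompl.codisjoint.eq_top)
  · rintro rfl
    exact hb (by simpa using h.isCompl.disjoint.eq_bot)

variable (𝕜 X) in
/-- The pairs `(E, F)` of mutually complementary elements of the Grassmannian. -/
structure ComplPair where
  E : Grassmannian 𝕜 X
  F : Grassmannian 𝕜 X
  compl : Grassmannian.Compl E F

/-- The chart around `E₀` defined by a complement `F₀`: it sends a complement `E` of `F₀` to the
unique `T : E₀ → F₀` such that `E = (I + T)(E₀)`. -/
def Grassmannian.chart (p : ComplPair 𝕜 X) :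
    PartialEquiv (Grassmannian 𝕜 X) (p.E.1 →L[𝕜] p.F.1) where
  toFun E := by
    classical exact if h : Submodule.IsTopCompl E.1 p.F.1 then
      -(Submodule.projectionOntoL p.F.1 E.1 h.symm ∘L p.E.1.subtypeL) else 0
  invFun T := ⟨graphSubspace T,
    Grassmannian.mem_of_isTopCompl (isTopCompl_graphSubspace p.compl T) p.F.2.1 p.F.2.2.1⟩
  source := Grassmannian.compls p.F
  target := univ
  map_source' _ _ := mem_univ _
  map_target' T _ := isTopCompl_graphSubspace p.compl T
  left_inv' := by
    intro E (hE : Submodule.IsTopCompl E.1 p.F.1)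
    have hp : Submodule.IsTopCompl p.E.1 p.F.1 := p.compl
    apply Subtype.ext
    have hsub : ∀ x : X, x - Submodule.projectionL p.F.1 E.1 hE.symm x
        = Submodule.projectionL E.1 p.F.1 hE x := by
      intro x
      rw [Submodule.projectionL_eq_self_sub_projectionL hE]
      abel
    simp only [hE, dite_true]
    apply le_antisymm
    · rintro _ ⟨x, rfl⟩
      have := Submodule.projectionL_apply_mem hE (x : X)
      rw [← hsub] at this
      simpa [sub_eq_add_neg] using this
    · intro y hy
      refine ⟨Submodule.projectionOntoL p.E.1 p.F.1 hp y, ?_⟩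
      have h1 := hsub (Submodule.projectionL p.E.1 p.F.1 hp y)
      have h2 : Submodule.projectionL E.1 p.F.1 hE (Submodule.projectionL p.E.1 p.F.1 hp y)
          = y := by
        have h3 := Submodule.projectionL_eq_self_sub_projectionL hp y
        have h4 : Submodule.projectionL E.1 p.F.1 hE
            (y - Submodule.projectionL p.E.1 p.F.1 hp y) = 0 := by
          rw [Submodule.projectionL_apply_eq_zero_iff, ← h3]
          exact Submodule.projectionL_apply_mem _ _
        rw [map_sub, sub_eq_zero, (Submodule.projectionL_eq_self_iff hE y).2 hy] at h4
        exact h4.symm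
      rw [h2] at h1
      simpa [sub_eq_add_neg] using h1
  right_inv' := by
    intro T _
    have hG := isTopCompl_graphSubspace p.compl T
    simp only [hG, dite_true]
    ext x
    have hx : (x : X) + (T x : X) ∈ graphSubspace T := ⟨x, by simp⟩
    have h1 : Submodule.projectionL p.F.1 _ hG.symm ((x : X) + (T x : X)) = 0 :=
      (Submodule.projectionL_apply_eq_zero_iff hG.symm).2 hx
    rw [map_add, Submodule.projectionL_apply_left hG.symm (T x)] at h1
    simpa using neg_eq_of_add_eq_zero_right h1

/-! ### The idempotents -/

variable (𝕜 X) in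
/-- The set of all idempotents in `L(X)` other than `0` and the identity. -/
def idempotents : Set (X →L[𝕜] X) :=
  {Q | Q ≠ 0 ∧ Q ≠ 1 ∧ Q * Q = Q}

/-- The map `κ` that sends an idempotent `Q` to its range `Q(X)`. -/
def rangeMap (Q : idempotents 𝕜 X) : Grassmannian 𝕜 X :=
  ⟨LinearMap.range Q.1.toLinearMap, by
    have hQ : IsIdempotentElem Q.1 := Q.2.2.2
    refine ⟨?_, ?_, (ContinuousLinearMap.IsIdempotentElem.isTopCompl hQ).closedComplemented⟩
    · intro h
      refine Q.2.1 (ContinuousLinearMap.ext fun x => ?_)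
      have hx : Q.1 x ∈ LinearMap.range Q.1.toLinearMap := ⟨x, rfl⟩
      rw [h] at hx
      simpa using hx
    · intro h
      refine Q.2.2.1 (ContinuousLinearMap.ext fun x => ?_)
      have hx : x ∈ LinearMap.range Q.1.toLinearMap := by
        rw [h]
        trivial
      obtain ⟨y, rfl⟩ := hx
      exact DFunLike.congr_fun hQ y⟩

/-- The closed subspace of `L(X)` of all `T` with `T(X) ⊆ F` and `T(F) = 0`. -/
def nilpotentsAt (F : Grassmannian 𝕜 X) : Submodule 𝕜 (X →L[𝕜] X) where
  carrier := {T | (∀ x, T x ∈ F.1) ∧ ∀ x ∈ F.1, T x = 0}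
  add_mem' := by
    rintro S T ⟨hS, hS'⟩ ⟨hT, hT'⟩
    exact ⟨fun x => F.1.add_mem (hS x) (hT x), fun x hx => by simp [hS' x hx, hT' x hx]⟩
  zero_mem' := ⟨fun _ => F.1.zero_mem, fun _ _ => rfl⟩
  smul_mem' := by
    rintro c T ⟨hT, hT'⟩
    exact ⟨fun x => F.1.smul_mem c (hT x), fun x hx => by simp [hT' x hx]⟩

theorem isClosed_nilpotentsAt (F : Grassmannian 𝕜 X) :
    IsClosed (nilpotentsAt F : Set (X →L[𝕜] X)) := by
  have hF : IsClosed (F.1 : Set X) := F.2.2.2.isClosed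
  have h : (nilpotentsAt F : Set (X →L[𝕜] X)) =
      (⋂ x, {T : X →L[𝕜] X | T x ∈ F.1}) ∩ ⋂ x ∈ F.1, {T : X →L[𝕜] X | T x = 0} := by
    ext T
    simp [nilpotentsAt]
  rw [h]
  refine (isClosed_iInter fun x => hF.preimage (by fun_prop)).inter
    (isClosed_biInter fun x _ => isClosed_eq (by fun_prop) continuous_const)

/-! ### The atlases of the Grassmannian and of the set of idempotents -/

variable [CompleteSpace X]

theorem Grassmannian.completeSpace (E : Grassmannian 𝕜 X) : CompleteSpace E.1 :=
  E.2.2.2.isClosed.completeSpace_coe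

variable (𝕜 X) in
/-- The standard atlas of the Grassmannian. -/
def grassmannCharts : ChartFamily.{u𝕜, uX, uX, uX} 𝕜 (Grassmannian 𝕜 X) where
  ι := ComplPair 𝕜 X
  Model p := p.E.1 →L[𝕜] p.F.1
  complete p := by
    have := p.F.completeSpace
    infer_instance
  chart p := Grassmannian.chart p

instance : TopologicalSpace (Grassmannian 𝕜 X) :=
  (grassmannCharts 𝕜 X).topology

instance (F : Grassmannian 𝕜 X) : CompleteSpace (nilpotentsAt F) :=
  (isClosed_nilpotentsAt F).completeSpace_coe

/-- The family of charts of the set of idempotents that consists of given maps `μ` into the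
spaces `nilpotentsAt F₀ × nilpotentsAt E₀`, for all complementary pairs `(E₀, F₀)`. -/
def idempotentCharts
    (μ : ∀ p : ComplPair 𝕜 X,
      PartialEquiv (idempotents 𝕜 X) (nilpotentsAt p.F × nilpotentsAt p.E)) :
    ChartFamily.{u𝕜, uX, uX, uX} 𝕜 (idempotents 𝕜 X) where
  ι := ComplPair 𝕜 X
  Model p := nilpotentsAt p.F × nilpotentsAt p.E
  normed _ := inferInstance
  space _ := inferInstance
  complete _ := inferInstance
  chart := μ

end Grassmannian

end

/-! Everything is expressed through the projection onto a subspace `E` along a fixed complement `F`,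
written `projAlong F E`. For fixed `F` it is an affine function of the chart coordinate of `E`
(`projAlong_eq_projOfChart`), so analyticity on the Grassmannian means analyticity of such
projections. If `E` is the range of an injection `j` and `π` is a projection with kernel `F`, then
`E` is a complement of `F` exactly when `π ∘ j` is invertible, and the projection is then `j (π j)⁻¹
π`. Since inversion is analytic on an open set, this one formula gives the transition maps of the
Grassmannian (`eventually_chart_symm`) and the analyticity of `κ`
(`eventually_compl_and_hasAnalyticExtensionAt`).

The idempotents form a submanifold because of block elimination at an idempotent `P` with `N = 1 -
P`. Write an operator near `P` as a 2×2 block matrix and divide its lower left block by the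
invertible upper left one. In the resulting coordinates the operator is idempotent exactly when both
diagonal coordinates vanish (`mul_self_iff_straighten`), so the slice is the space of off-diagonal
matrices.

Let `P` be the projection onto `E₀` along `F₀` and `R` the difference of the projections onto `E`
and `E₀` along `F₀`. Then `R * R = 0`, so `1 + R` has inverse `1 - R`; it fixes `F₀` pointwise and
maps `E₀` onto `E`. Conjugation by `1 + R` therefore carries the idempotents with range `E₀` onto
those with range `E`, affinely in the idempotent and analytically in `E`: this is the local
trivialization. The fiber over `E₀` is `P` plus the operators `S` that map into `E₀` and vanish on
it, and the conjugate `(1 + R)(P + S)(1 - R)` expands to the stated formula for the inverse of `μ`.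
-/

noncomputable section

universe u𝕜 uM uN uι uι' uE uE' uX uY

/-! ### Topology and analytic maps defined by charts. -/

namespace ChartFamily

variable {𝕜 : Type u𝕜} [NontriviallyNormedField 𝕜] {M : Type uM} {N : Type uN}

theorem isOpen_topology_iff {A : ChartFamily.{u𝕜, uM, uι, uE} 𝕜 M}
    (ht : ∀ i, IsOpen (A.chart i).target) {U : Set M} :
    IsOpen[A.topology] U ↔
      ∀ i, IsOpen ((A.chart i).target ∩ (A.chart i).symm ⁻¹' U) := by
  rw [isOpen_iSup_iff]
  refine forall_congr' fun i => ?_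
  rw [isOpen_coinduced, (ht i).isOpenEmbedding_subtypeVal.isOpen_iff_image_isOpen]
  have : (Subtype.val '' ((fun t : (A.chart i).target => (A.chart i).symm t) ⁻¹' U)) =
      (A.chart i).target ∩ (A.chart i).symm ⁻¹' U := by
    ext t
    simp [and_comm]
  rw [this]

/-- Charts with analytic transition maps form an analytic atlas for the topology they define. -/
theorem isAnalyticAtlas_topology {A : ChartFamily.{u𝕜, uM, uι, uE} 𝕜 M}
    (hc : ∀ x, ∃ i, x ∈ (A.chart i).source) (ht : ∀ i, IsOpen (A.chart i).target)
    (ho : ∀ i j, IsOpen ((A.chart i).symm.trans (A.chart j)).source)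
    (ha : ∀ i j, AnalyticOnNhd 𝕜 (A.chart j ∘ (A.chart i).symm)
      ((A.chart i).symm.trans (A.chart j)).source) :
    @IsAnalyticAtlas 𝕜 _ M A.topology A := by
  let := A.topology
  have hs : ∀ i, IsOpen (A.chart i).source := fun j => by
    rw [isOpen_topology_iff ht]
    intro i
    simpa using ho i j
  refine ⟨hc, hs, ht, fun j => ?_, fun i => ?_, ha⟩
  · rw [continuousOn_open_iff (hs j)]
    intro V hV
    rw [isOpen_topology_iff ht]
    intro i
    -- Read in chart `i`, the preimage of `V` under chart `j` is its preimage under the transition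
    -- map, which is continuous because it is analytic.
    convert (ha i j).continuousOn.isOpen_inter_preimage (ho i j) hV using 1
    ext t
    simp [and_assoc]
  · rw [continuousOn_open_iff (ht i)]
    intro V hV
    exact (isOpen_topology_iff ht).1 hV i

theorem IsAnalyticAtlas.continuousAt [TopologicalSpace M] {A : ChartFamily.{u𝕜, uM, uι, uE} 𝕜 M}
    (hA : A.IsAnalyticAtlas) {i : A.ι} {x : M} (hx : x ∈ (A.chart i).source) :
    ContinuousAt (A.chart i) x :=
  (hA.continuousOn i).continuousAt ((hA.isOpen_source i).mem_nhds hx)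

theorem IsAnalyticAtlas.continuousAt_symm [TopologicalSpace M]
    {A : ChartFamily.{u𝕜, uM, uι, uE} 𝕜 M}
    (hA : A.IsAnalyticAtlas) {i : A.ι} {x : M} (hx : x ∈ (A.chart i).source) :
    ContinuousAt (A.chart i).symm (A.chart i x) :=
  (hA.continuousOn_symm i).continuousAt
    ((hA.isOpen_target i).mem_nhds ((A.chart i).map_source hx))

theorem IsAnalyticAtlas.continuousAt_of_chart [TopologicalSpace M] [TopologicalSpace N]
    {B : ChartFamily.{u𝕜, uN, uι', uE'} 𝕜 N} (hB : B.IsAnalyticAtlas) {f : M → N} {x : M}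
    {j : B.ι} (hx : ∀ᶠ y in 𝓝 x, f y ∈ (B.chart j).source)
    (hf : ContinuousAt (fun y => B.chart j (f y)) x) : ContinuousAt f x := by
  have h := ContinuousAt.comp (f := fun y => B.chart j (f y)) (g := (B.chart j).symm)
    (hB.continuousAt_symm hx.self_of_nhds) hf
  refine h.congr ?_
  filter_upwards [hx] with y hy
  exact (B.chart j).left_inv hy

/-- Continuity comes for free from the analytic chart readings once `f` is known to stay in the
chart near `x`; without that condition the reading could consist of default values of the chart. -/
theorem IsAnalyticAtlas.isAnalyticOn [TopologicalSpace M] [TopologicalSpace N]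
    {A : ChartFamily.{u𝕜, uM, uι, uE} 𝕜 M} {B : ChartFamily.{u𝕜, uN, uι', uE'} 𝕜 N}
    (hA : A.IsAnalyticAtlas) (hB : B.IsAnalyticAtlas) {f : M → N} {s : Set M}
    (h : ∀ x ∈ s, ∀ i j, x ∈ (A.chart i).source → f x ∈ (B.chart j).source →
      (∀ᶠ y in 𝓝 x, f y ∈ (B.chart j).source) ∧
      AnalyticAt 𝕜 (B.chart j ∘ f ∘ (A.chart i).symm) (A.chart i x)) :
    A.IsAnalyticOn B f s := by
  refine ⟨fun x hx => ?_, fun x hx i j hi hj => (h x hx i j hi hj).2⟩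
  obtain ⟨i, hi⟩ := hA.covers x
  obtain ⟨j, hj⟩ := hB.covers (f x)
  obtain ⟨h1, h2⟩ := h x hx i j hi hj
  refine (hB.continuousAt_of_chart h1 ?_).continuousWithinAt
  have h3 := ContinuousAt.comp (f := A.chart i) h2.continuousAt (hA.continuousAt hi)
  refine h3.congr ?_
  filter_upwards [(hA.isOpen_source i).mem_nhds hi] with y hy
  simp [(A.chart i).left_inv hy]

end ChartFamily

/-! ### Analytic maps on and into a subset of a Banach space. -/

section Submanifold

variable {𝕜 : Type u𝕜} [NontriviallyNormedField 𝕜] {Y : Type uY} [NormedAddCommGroup Y]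
  [NormedSpace 𝕜 Y]

theorem Submodule.analyticAt_coe (V : Submodule 𝕜 Y) (v : V) :
    AnalyticAt 𝕜 (fun v : V => (v : Y)) v := V.subtypeL.analyticAt v

/-- A map into a complemented subspace is analytic if it is analytic as a map into the space. -/
theorem Submodule.ClosedComplemented.analyticAt {V : Submodule 𝕜 Y} (hV : V.ClosedComplemented)
    {E : Type*} [NormedAddCommGroup E] [NormedSpace 𝕜 E] {f : E → V} {x : E}
    (hf : AnalyticAt 𝕜 (fun y => (f y : Y)) x) : AnalyticAt 𝕜 f x := by
  obtain ⟨π, hπ⟩ := hV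
  have h := (π.analyticAt _).comp hf
  exact h.congr (Filter.Eventually.of_forall fun y => hπ (f y))

/-- Near `x`, the map `h` defined on a subset `S` of a Banach space extends to a map that is
analytic at `x`. -/
def HasAnalyticExtensionAt (𝕜 : Type u𝕜) [NontriviallyNormedField 𝕜] {Y : Type uY}
    [NormedAddCommGroup Y] [NormedSpace 𝕜 Y] {S : Set Y}
    {Z : Type*} [NormedAddCommGroup Z] [NormedSpace 𝕜 Z] (h : S → Z) (x : S) : Prop :=
  ∃ g : Y → Z, AnalyticAt 𝕜 g x ∧ ∀ᶠ s in 𝓝 x, h s = g s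

namespace HasAnalyticExtensionAt

variable {S : Set Y} {Z : Type*} [NormedAddCommGroup Z] [NormedSpace 𝕜 Z]
  {W : Type*} [NormedAddCommGroup W] [NormedSpace 𝕜 W] {x : S}

theorem coe (x : S) : HasAnalyticExtensionAt 𝕜 ((↑) : S → Y) x :=
  ⟨id, analyticAt_id, Filter.Eventually.of_forall fun _ => rfl⟩

theorem comp {h : S → Z} {g : Z → W} (hg : AnalyticAt 𝕜 g (h x))
    (hh : HasAnalyticExtensionAt 𝕜 h x) : HasAnalyticExtensionAt 𝕜 (fun s => g (h s)) x := by
  obtain ⟨k, hk, hhk⟩ := hh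
  rw [hhk.self_of_nhds] at hg
  exact ⟨g ∘ k, hg.comp hk, hhk.mono fun s hs => by simp [hs]⟩

theorem prodMk {h : S → Z} {k : S → W} (hh : HasAnalyticExtensionAt 𝕜 h x)
    (hk : HasAnalyticExtensionAt 𝕜 k x) : HasAnalyticExtensionAt 𝕜 (fun s => (h s, k s)) x := by
  obtain ⟨f, hf, hhf⟩ := hh
  obtain ⟨g, hg, hkg⟩ := hk
  exact ⟨fun y => (f y, g y), hf.prod hg, by
    filter_upwards [hhf, hkg] with s h1 h2
    rw [h1, h2]⟩

theorem congr {h k : S → Z} (hh : HasAnalyticExtensionAt 𝕜 h x) (e : ∀ᶠ s in 𝓝 x, k s = h s) :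
    HasAnalyticExtensionAt 𝕜 k x := by
  obtain ⟨f, hf, hhf⟩ := hh
  exact ⟨f, hf, by
    filter_upwards [hhf, e] with s h1 h2
    rw [h2, h1]⟩

theorem codRestrict {V : Submodule 𝕜 Z} (hV : V.ClosedComplemented) {h : S → V}
    (hh : HasAnalyticExtensionAt 𝕜 (fun s => (h s : Z)) x) : HasAnalyticExtensionAt 𝕜 h x := by
  obtain ⟨π, hπ⟩ := hV
  exact (hh.comp (π.analyticAt _)).congr
    (Filter.Eventually.of_forall fun s => (hπ (h s)).symm)

theorem continuousAt {h : S → Z} (hh : HasAnalyticExtensionAt 𝕜 h x) : ContinuousAt h x := by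
  obtain ⟨f, hf, hhf⟩ := hh
  have h1 : ContinuousAt (fun s : S => f s) x :=
    ContinuousAt.comp (f := ((↑) : S → Y)) hf.continuousAt continuous_subtype_val.continuousAt
  exact h1.congr (hhf.mono fun s hs => hs.symm)

end HasAnalyticExtensionAt

namespace SliceChart

variable {S : Set Y} (c : SliceChart 𝕜 S)

theorem coe_restrict {s : S} (hs : s ∈ (c.restrict 𝕜).source) :
    ((c.restrict 𝕜) s : Y) = c.toHomeo s := by
  have h := (c.mem_iff s hs).1 s.2
  simp [restrict, h]

theorem coe_restrict_symm {t : c.slice} (ht : t ∈ (c.restrict 𝕜).target) :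
    ((c.restrict 𝕜).symm t : Y) = c.toHomeo.symm t := by
  have h : c.toHomeo.symm t ∈ S := by
    rw [c.mem_iff _ (c.toHomeo.map_target ht), c.toHomeo.right_inv ht]
    exact t.2
  simp [restrict, h]

theorem isOpen_source : IsOpen (c.restrict 𝕜).source :=
  c.toHomeo.open_source.preimage continuous_subtype_val

theorem isOpen_target : IsOpen (c.restrict 𝕜).target :=
  c.toHomeo.open_target.preimage continuous_subtype_val

theorem continuousAt_symm {t : c.slice} (ht : t ∈ (c.restrict 𝕜).target) :
    ContinuousAt (c.restrict 𝕜).symm t := by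
  rw [IsInducing.subtypeVal.continuousAt_iff]
  have h : ContinuousAt (fun t : c.slice => c.toHomeo.symm t) t :=
    ContinuousAt.comp (f := ((↑) : c.slice → Y)) (c.toHomeo.continuousAt_symm ht)
      continuous_subtype_val.continuousAt
  refine h.congr ?_
  filter_upwards [c.isOpen_target.mem_nhds ht] with t ht
  exact (c.coe_restrict_symm ht).symm

/-- Reading a map in a slice chart. -/
theorem analyticAt_comp_symm {Z : Type*} [NormedAddCommGroup Z] [NormedSpace 𝕜 Z] {h : S → Z}
    {x : S} (hx : x ∈ (c.restrict 𝕜).source) (hh : HasAnalyticExtensionAt 𝕜 h x) :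
    AnalyticAt 𝕜 (h ∘ (c.restrict 𝕜).symm) ((c.restrict 𝕜) x) := by
  obtain ⟨g, hg, hhg⟩ := hh
  have ht := (c.restrict 𝕜).map_source hx
  have hl := (c.restrict 𝕜).left_inv hx
  have h1 : AnalyticAt 𝕜 (fun t : c.slice => c.toHomeo.symm t) ((c.restrict 𝕜) x) :=
    AnalyticAt.fun_comp (c.analytic_symm _ ht) (c.slice.subtypeL.analyticAt _)
  have hv : c.toHomeo.symm ((c.restrict 𝕜) x) = x := by
    rw [← c.coe_restrict_symm ht, hl]
  have h2 : AnalyticAt 𝕜 (fun t : c.slice => g (c.toHomeo.symm t)) ((c.restrict 𝕜) x) :=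
    AnalyticAt.fun_comp (by rwa [hv]) h1
  refine h2.congr ?_
  have h3 := c.continuousAt_symm ht
  rw [ContinuousAt, hl] at h3
  filter_upwards [c.isOpen_target.mem_nhds ht, h3.eventually hhg] with t ht1 ht2
  simp [ht2, c.coe_restrict_symm ht1]

theorem hasAnalyticExtensionAt {x : S} (hx : x ∈ (c.restrict 𝕜).source) :
    HasAnalyticExtensionAt 𝕜 (c.restrict 𝕜) x := by
  refine HasAnalyticExtensionAt.codRestrict c.complemented
    ⟨c.toHomeo, c.analytic _ hx, ?_⟩
  filter_upwards [c.isOpen_source.mem_nhds hx] with s hs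
  exact c.coe_restrict hs

theorem analyticAt_restrict_comp {E : Type*} [NormedAddCommGroup E] [NormedSpace 𝕜 E] {f : E → S}
    {x : E} (hf : AnalyticAt 𝕜 (fun y => (f y : Y)) x) (hx : f x ∈ (c.restrict 𝕜).source) :
    AnalyticAt 𝕜 ((c.restrict 𝕜) ∘ f) x := by
  refine Submodule.ClosedComplemented.analyticAt c.complemented ?_
  refine (AnalyticAt.fun_comp (g := c.toHomeo) (f := fun y => (f y : Y))
    (c.analytic _ hx) hf).congr ?_
  filter_upwards [hf.continuousAt.eventually (c.toHomeo.open_source.mem_nhds hx)] with y hy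
  exact (c.coe_restrict hy).symm

end SliceChart

variable [CompleteSpace Y]

/-- Only covering has to be checked. Slice charts are compatible automatically, since they and their
inverses are restrictions of analytic maps of the ambient space, and a bounded projection onto the
slice keeps analyticity when the codomain is restricted. -/
theorem isAnalyticAtlas_submanifoldCharts {S : Set Y}
    (h : ∀ x : S, ∃ c : SliceChart 𝕜 S, (x : Y) ∈ c.toHomeo.source) :
    (submanifoldCharts 𝕜 S).IsAnalyticAtlas where
  covers := h
  isOpen_source c := SliceChart.isOpen_source c
  isOpen_target c := SliceChart.isOpen_target c
  continuousOn c x hx :=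
    (SliceChart.hasAnalyticExtensionAt c hx).continuousAt.continuousWithinAt
  continuousOn_symm c t ht := (SliceChart.continuousAt_symm c ht).continuousWithinAt
  analytic_transition c d := by
    rintro t ⟨ht, ht'⟩
    have h1 : (c.restrict 𝕜) ((c.restrict 𝕜).symm t) = t := (c.restrict 𝕜).right_inv ht
    have h2 := SliceChart.analyticAt_comp_symm c ((c.restrict 𝕜).map_target ht)
      (SliceChart.hasAnalyticExtensionAt d ht')
    rw [h1] at h2
    exact h2

theorem isAnalyticOn_from_submanifold {S : Set Y} {N : Type uN} [TopologicalSpace N]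
    {B : ChartFamily.{u𝕜, uN, uι', uE'} 𝕜 N} {f : S → N} {s : Set S} (hc : ContinuousOn f s)
    (hf : ∀ x ∈ s, ∀ j, f x ∈ (B.chart j).source →
      HasAnalyticExtensionAt 𝕜 (fun y => B.chart j (f y)) x) :
    (submanifoldCharts 𝕜 S).IsAnalyticOn B f s :=
  ⟨hc, fun x hx c j hi hj => SliceChart.analyticAt_comp_symm c hi (hf x hx j hj)⟩

theorem isAnalyticOn_to_submanifold {S : Set Y} {M : Type uM} [TopologicalSpace M]
    {A : ChartFamily.{u𝕜, uM, uι, uE} 𝕜 M} {f : M → S} {s : Set M} (hc : ContinuousOn f s)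
    (hf : ∀ x ∈ s, ∀ i, x ∈ (A.chart i).source →
      AnalyticAt 𝕜 (fun t => (f ((A.chart i).symm t) : Y)) (A.chart i x)) :
    A.IsAnalyticOn (submanifoldCharts 𝕜 S) f s := by
  refine ⟨hc, fun x hx i c hi hj => ?_⟩
  refine SliceChart.analyticAt_restrict_comp c (hf x hx i hi) ?_
  rwa [Function.comp_apply, (A.chart i).left_inv hi]

end Submanifold

/-! ### Block elimination and slice charts for idempotents. -/

section IdempotentChart

variable {𝕜 : Type u𝕜} [NontriviallyNormedField 𝕜] {𝔸 : Type uY} [NormedRing 𝔸]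
  [NormedAlgebra 𝕜 𝔸]

/-- The pivot block of `T` with respect to an idempotent `P` and `N = 1 - P`, completed to an
element of the whole algebra. -/
def pivot (P N T : 𝔸) : 𝔸 := P * T * P + N

/-- The lower left block of `T`, divided by the pivot. -/
def lowerFactor (P N T : 𝔸) : 𝔸 := N * T * P * Ring.inverse (pivot P N T)

/-- The straightening map of the set of idempotents near `P`. -/
def straighten (P N T : 𝔸) : 𝔸 :=
  lowerFactor P N T + P * T * N + (P * T * P - P + P * T * N * lowerFactor P N T) +
    (N * T * N - lowerFactor P N T * (P * T * N))

/-- The upper left block of `unstraighten P N Z`. -/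
def corner (P N Z : 𝔸) : 𝔸 := P + P * Z * P - P * Z * N * (N * Z * P)

/-- The inverse of the straightening map. -/
def unstraighten (P N Z : 𝔸) : 𝔸 :=
  corner P N Z + P * Z * N + N * Z * P * corner P N Z + (N * Z * N + N * Z * P * (P * Z * N))

variable {P N : 𝔸}

/-- The pivot is block diagonal, so it commutes with `P`, and so does its inverse. Hence the inverse
restricts to an inverse of `P * T * P` in the corner algebra with unit `P`. -/
theorem pivot_inverse (hP : P * P = P) (hPN : P * N = 0) (hNP : N * P = 0) {T : 𝔸}
    (hu : IsUnit (pivot P N T)) :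
    P * Ring.inverse (pivot P N T) = Ring.inverse (pivot P N T) * P ∧
      P * T * P * Ring.inverse (pivot P N T) = P ∧
      Ring.inverse (pivot P N T) * (P * T * P) = P := by
  set v := Ring.inverse (pivot P N T)
  have h1 : v * pivot P N T = 1 := Ring.inverse_mul_cancel _ hu
  have h2 : pivot P N T * v = 1 := Ring.mul_inverse_cancel _ hu
  have hc : pivot P N T * P = P * pivot P N T := by
    simp only [pivot, add_mul, mul_add, mul_assoc, hP, hPN, hNP]
    simp only [← mul_assoc, hP]
  have hPv : P * v = v * P := by
    calc P * v = v * pivot P N T * (P * v) := by rw [h1, one_mul]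
      _ = v * (pivot P N T * P) * v := by simp only [mul_assoc]
      _ = v * P * (pivot P N T * v) := by rw [hc]; simp only [mul_assoc]
      _ = v * P := by rw [h2, mul_one]
  have hp : P * pivot P N T = P * T * P := by
    simp only [pivot, mul_add, ← mul_assoc, hP, hPN, add_zero]
  refine ⟨hPv, ?_, ?_⟩
  · rw [← hp, mul_assoc, h2, mul_one]
  · rw [← hp, ← mul_assoc, ← hPv, mul_assoc, h1, mul_one]

/-- The four summands of `straighten` lie in four different corners, so multiplying by `P` or `N` on
each side isolates one of them. -/
theorem straighten_blocks (hP : P * P = P) (hN : N * N = N) (hPN : P * N = 0) (hNP : N * P = 0)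
    {T : 𝔸} (hu : IsUnit (pivot P N T)) :
    N * straighten P N T * P = lowerFactor P N T ∧
    P * straighten P N T * N = P * T * N ∧
    P * straighten P N T * P = P * T * P - P + P * T * N * lowerFactor P N T ∧
    N * straighten P N T * N = N * T * N - lowerFactor P N T * (P * T * N) := by
  obtain ⟨h1, h2, h3⟩ := pivot_inverse hP hPN hNP hu
  have hNr : N * lowerFactor P N T = lowerFactor P N T := by
    simp only [lowerFactor, ← mul_assoc, hN]
  have hrP : lowerFactor P N T * P = lowerFactor P N T := by
    rw [lowerFactor, mul_assoc, ← h1, ← mul_assoc, mul_assoc _ P P, hP]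
  have hPr : P * lowerFactor P N T = 0 := by rw [← hNr, ← mul_assoc, hPN, zero_mul]
  have hrN : lowerFactor P N T * N = 0 := by rw [← hrP, mul_assoc, hPN, mul_zero]
  rw [straighten]
  set R := lowerFactor P N T
  have aux : ∀ {a b : 𝔸}, a * b = 0 → ∀ x, a * (b * x) = 0 := fun h x => by
    rw [← mul_assoc, h, zero_mul]
  have aux' : ∀ {a b c : 𝔸}, a * b = c → ∀ x, a * (b * x) = c * x := fun h x => by
    rw [← mul_assoc, h]
  refine ⟨?_, ?_, ?_, ?_⟩ <;>
  simp only [mul_add, add_mul, mul_sub, sub_mul, mul_assoc, hP, hN, hPN, hNP, hNr, hrP, hPr, hrN,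
    aux hPN, aux hNP, aux hPr, aux' hP, aux' hN, aux' hNr, aux' hrP, mul_zero, add_zero, zero_add,
    sub_self]

theorem unstraighten_straighten (hP : P * P = P) (hN : N * N = N) (hPN : P * N = 0)
    (hNP : N * P = 0) (hs : P + N = 1) {T : 𝔸} (hu : IsUnit (pivot P N T)) :
    corner P N (straighten P N T) = P * T * P ∧ unstraighten P N (straighten P N T) = T := by
  obtain ⟨b1, b2, b3, b4⟩ := straighten_blocks hP hN hPN hNP hu
  obtain ⟨h1, h2, h3⟩ := pivot_inverse hP hPN hNP hu
  have hc : corner P N (straighten P N T) = P * T * P := by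
    rw [corner, b1, b2, b3]
    abel
  refine ⟨hc, ?_⟩
  rw [unstraighten, hc, b1, b2, b4]
  have hR : lowerFactor P N T * (P * T * P) = N * T * P := by
    rw [lowerFactor, mul_assoc, h3, mul_assoc, hP]
  rw [hR]
  have : T = (P + N) * T * (P + N) := by rw [hs, one_mul, mul_one]
  conv_rhs => rw [this]
  simp only [mul_add, add_mul]
  abel

theorem unstraighten_blocks (hP : P * P = P) (hN : N * N = N) (hPN : P * N = 0)
    (hNP : N * P = 0) (Z : 𝔸) :
    P * unstraighten P N Z * P = corner P N Z ∧
    P * unstraighten P N Z * N = P * Z * N ∧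
    N * unstraighten P N Z * P = N * Z * P * corner P N Z ∧
    N * unstraighten P N Z * N = N * Z * N + N * Z * P * (P * Z * N) := by
  have aux : ∀ {a b : 𝔸}, a * b = 0 → ∀ x, a * (b * x) = 0 := fun h x => by
    rw [← mul_assoc, h, zero_mul]
  have aux' : ∀ {a b c : 𝔸}, a * b = c → ∀ x, a * (b * x) = c * x := fun h x => by
    rw [← mul_assoc, h]
  refine ⟨?_, ?_, ?_, ?_⟩ <;>
  simp only [unstraighten, corner, mul_add, add_mul, mul_sub, sub_mul, mul_assoc, hP, hN, hPN, hNP,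
    aux hPN, aux hNP, aux' hP, aux' hN, mul_zero, add_zero, zero_add, sub_self]

/-- The element assumed invertible is the pivot of `unstraighten P N Z`, so division by it returns
the lower left block of `Z`. -/
theorem straighten_unstraighten (hP : P * P = P) (hN : N * N = N) (hPN : P * N = 0)
    (hNP : N * P = 0) (hs : P + N = 1) {Z : 𝔸} (hu : IsUnit (corner P N Z + N)) :
    IsUnit (pivot P N (unstraighten P N Z)) ∧ straighten P N (unstraighten P N Z) = Z := by
  obtain ⟨b1, b2, b3, b4⟩ := unstraighten_blocks hP hN hPN hNP Z
  have hp : pivot P N (unstraighten P N Z) = corner P N Z + N := by rw [pivot, b1]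
  have hu' : IsUnit (pivot P N (unstraighten P N Z)) := by rwa [hp]
  obtain ⟨h1, h2, h3⟩ := pivot_inverse hP hPN hNP hu'
  refine ⟨hu', ?_⟩
  have hR : lowerFactor P N (unstraighten P N Z) = N * Z * P := by
    rw [b1] at h2
    rw [lowerFactor, b3, mul_assoc, h2, mul_assoc, hP]
  rw [straighten, hR, b1, b2, b4, corner]
  have : Z = (P + N) * Z * (P + N) := by rw [hs, one_mul, mul_one]
  conv_rhs => rw [this]
  simp only [mul_add, add_mul]
  abel

/-- If the lower right block in the straightening of `T` is small, then `T` is idempotent if and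
only if both diagonal blocks of the straightening vanish. -/
theorem mul_self_iff_straighten (hP : P * P = P) (hN : N * N = N) (hPN : P * N = 0)
    (hNP : N * P = 0) (hs : P + N = 1) {T : 𝔸} (hu : IsUnit (pivot P N T))
    (hsmall : ‖N * straighten P N T * N‖ < 1) :
    T * T = T ↔ P * straighten P N T * P = 0 ∧ N * straighten P N T * N = 0 := by
  obtain ⟨-, h2, -⟩ := pivot_inverse hP hPN hNP hu
  obtain ⟨hA, hT⟩ := unstraighten_straighten hP hN hPN hNP hs hu
  rw [← hA] at h2
  set v := Ring.inverse (pivot P N T)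
  rw [unstraighten] at hT
  have hA' : corner P N (straighten P N T) = P + P * straighten P N T * P -
    P * straighten P N T * N * (N * straighten P N T * P) := rfl
  have aux : ∀ {a b : 𝔸}, a * b = 0 → ∀ x, a * (b * x) = 0 := fun h x => by
    rw [← mul_assoc, h, zero_mul]
  have aux' : ∀ {a b c : 𝔸}, a * b = c → ∀ x, a * (b * x) = c * x := fun h x => by
    rw [← mul_assoc, h]
  have left : ∀ a, P * (P * a) = P * a ∧ N * (N * a) = N * a ∧ P * (N * a) = 0 ∧
      N * (P * a) = 0 := fun a => ⟨aux' hP a, aux' hN a, aux hPN a, aux hNP a⟩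
  have right : ∀ a, a * P * P = a * P ∧ a * N * N = a * N ∧ a * P * N = 0 ∧
      a * N * P = 0 := fun a => by simp only [mul_assoc, hP, hN, hPN, hNP, mul_zero, and_self]
  have hPA : P * corner P N (straighten P N T) = corner P N (straighten P N T) := by
    rw [hA', mul_sub, mul_add, hP]; simp only [mul_assoc, left]
  have hAP : corner P N (straighten P N T) * P = corner P N (straighten P N T) := by
    rw [hA', sub_mul, add_mul, hP, (right _).1, ← mul_assoc, (right _).1]
  have hPs : P * (P * straighten P N T * N) = P * straighten P N T * N := by
    simp only [mul_assoc, left]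
  have hsN : P * straighten P N T * N * N = P * straighten P N T * N := by simp only [right]
  have hNr : N * (N * straighten P N T * P) = N * straighten P N T * P := by
    simp only [mul_assoc, left]
  have hrP : N * straighten P N T * P * P = N * straighten P N T * P := by simp only [right]
  have hNd : N * (N * straighten P N T * N) = N * straighten P N T * N := by
    simp only [mul_assoc, left]
  have hdN : N * straighten P N T * N * N = N * straighten P N T * N := by simp only [right]
  -- The blocks become free variables, with `A = P + e - s * r` and `T = A + s + r * A + (d + r *
  -- s)`; from here on only their corner relations matter.
  generalize hdd : N * straighten P N T * N = d at *
  generalize N * straighten P N T * P = r at *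
  generalize P * straighten P N T * N = s at *
  generalize P * straighten P N T * P = e at *
  generalize corner P N (straighten P N T) = A at *
  have hNA : N * A = 0 := by rw [← hPA, ← mul_assoc, hNP, zero_mul]
  have hAN : A * N = 0 := by rw [← hAP, mul_assoc, hPN, mul_zero]
  have hNs : N * s = 0 := by rw [← hPs, ← mul_assoc, hNP, zero_mul]
  have hsP : s * P = 0 := by rw [← hsN, mul_assoc, hNP, mul_zero]
  have hPr : P * r = 0 := by rw [← hNr, ← mul_assoc, hPN, zero_mul]
  have hrN : r * N = 0 := by rw [← hrP, mul_assoc, hPN, mul_zero]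
  have hPd : P * d = 0 := by rw [← hNd, ← mul_assoc, hPN, zero_mul]
  have hdP : d * P = 0 := by rw [← hdN, mul_assoc, hNP, mul_zero]
  have orth : ∀ {a b : 𝔸}, a * P = a → N * b = b → a * b = 0 := fun {a b} h h' => by
    rw [← h, ← h', mul_assoc, ← mul_assoc P, hPN, zero_mul, mul_zero]
  have orth' : ∀ {a b : 𝔸}, a * N = a → P * b = b → a * b = 0 := fun {a b} h h' => by
    rw [← h, ← h', mul_assoc, ← mul_assoc N, hNP, zero_mul, mul_zero]
  have hrr : r * r = 0 := orth hrP hNr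
  have hrd : r * d = 0 := orth hrP hNd
  have hAr : A * r = 0 := orth hAP hNr
  have hAd : A * d = 0 := orth hAP hNd
  have hsA : s * A = 0 := orth' hsN hPA
  have hss : s * s = 0 := orth' hsN hPs
  have hds : d * s = 0 := orth' hdN hPs
  have hdA : d * A = 0 := orth' hdN hPA
  constructor
  · intro hi
    -- Left multiplication by `1 - r` is the elimination step: it clears the lower left block and
    -- leaves the Schur complement `d` in the lower right.
    have h4 : (1 - r) * T = A + s + d := by
      rw [← hT]
      simp only [sub_mul, one_mul, mul_add, ← mul_assoc, hrr, hrd, zero_mul]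
      abel
    have h5 : (A + s + d) * T = A + s + d := by
      rw [← h4, mul_assoc, hi]
    rw [← hT] at h5
    simp only [add_mul, mul_add, ← mul_assoc, hAr, hAd, hsA, hss, hds, hdA, zero_add,
      add_zero] at h5
    -- Three corners of the identity: `A * A + s * r * A = A`, `d * r * A = 0` and `d * r * s + d *
    -- d = d`.
    have e1 := congrArg (fun x => P * x * P) h5
    have e2 := congrArg (fun x => N * x * P) h5
    have e3 := congrArg (fun x => N * x * N) h5
    simp only [add_mul, mul_add, ← mul_assoc, hPA, hPs, hPd, hNA, hNs, hNd, zero_mul, zero_add,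
      add_zero] at e1 e2 e3
    simp only [mul_assoc, hAP, hAN, hsP, hsN, hdP, hdN, mul_zero, add_zero, zero_add] at e1 e2 e3
    -- `A` cancels on the right, because `A * v = P`.
    have hdr : d * r = 0 := by
      calc d * r = d * (r * (A * v)) := by rw [h2, hrP]
        _ = d * (r * A) * v := by simp only [mul_assoc]
        _ = 0 := by rw [e2, zero_mul]
    have hdd' : d * d = d := by
      rwa [← mul_assoc, hdr, zero_mul, add_zero] at e3
    refine ⟨?_, ?_⟩
    · have : A + s * r = P := by
        calc A + s * r = A * (A * v) + s * (r * (A * v)) := by rw [h2, hAP, hrP]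
          _ = (A * A + s * (r * A)) * v := by simp only [mul_assoc, add_mul]
          _ = P := by rw [e1, h2]
      rw [hA', sub_add_cancel] at this
      simpa using this
    -- A non-zero idempotent has norm at least 1, against the smallness of `d`.
    · by_contra hne
      have h6 : 0 < ‖d‖ := norm_pos_iff.2 hne
      have h7 : ‖d‖ ≤ ‖d‖ * ‖d‖ := by
        conv_lhs => rw [← hdd']
        exact norm_mul_le _ _
      nlinarith
  · rintro ⟨rfl, rfl⟩
    -- With `e = d = 0`, `T` is conjugate to the idempotent `P + s` by the unipotent element `1 +
    -- r`.
    have hT' : T = (1 + r) * (P + s) * (1 - r) := by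
      rw [← hT, hA']
      simp only [mul_add, mul_sub, add_mul, hrP, hPr, one_mul, mul_one, zero_add, add_zero,
        mul_assoc, hrr]
      abel
    have h8 : (1 - r) * (1 + r) = 1 := by
      simp only [mul_add, sub_mul, hrr, mul_one, one_mul]
      abel
    have h9 : (P + s) * (P + s) = P + s := by
      simp only [mul_add, add_mul, hP, hPs, hsP, hss, add_zero]
    calc T * T = (1 + r) * (P + s) * ((1 - r) * (1 + r)) * (P + s) * (1 - r) := by
          rw [hT']; simp only [mul_assoc]
      _ = (1 + r) * ((P + s) * (P + s)) * (1 - r) := by rw [h8, mul_one]; simp only [mul_assoc]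
      _ = T := by rw [h9, hT']

theorem analyticAt_pivot (T : 𝔸) : AnalyticAt 𝕜 (pivot P N) T := by
  unfold pivot
  fun_prop

theorem analyticAt_lowerFactor [CompleteSpace 𝔸] {T : 𝔸} (hu : IsUnit (pivot P N T)) :
    AnalyticAt 𝕜 (lowerFactor P N) T := by
  obtain ⟨u, hu⟩ := hu
  have h := analyticAt_inverse (𝕜 := 𝕜) u
  rw [hu] at h
  have h' := AnalyticAt.fun_comp h (analyticAt_pivot T)
  unfold lowerFactor
  fun_prop

theorem analyticAt_straighten [CompleteSpace 𝔸] {T : 𝔸} (hu : IsUnit (pivot P N T)) :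
    AnalyticAt 𝕜 (straighten P N) T := by
  have h := analyticAt_lowerFactor (𝕜 := 𝕜) hu
  unfold straighten
  fun_prop

theorem analyticAt_corner (Z : 𝔸) : AnalyticAt 𝕜 (corner P N) Z := by
  unfold corner
  fun_prop

theorem analyticAt_unstraighten (Z : 𝔸) : AnalyticAt 𝕜 (unstraighten P N) Z := by
  have h := analyticAt_corner (𝕜 := 𝕜) (P := P) (N := N) Z
  unfold unstraighten
  fun_prop

variable (𝕜) in
/-- The straightening map as a homeomorphism between open sets. -/
def straightenHomeo [CompleteSpace 𝔸] (hP : P * P = P) (hN : N * N = N) (hPN : P * N = 0)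
    (hNP : N * P = 0) (hs : P + N = 1) : OpenPartialHomeomorph 𝔸 𝔸 where
  toFun := straighten P N
  invFun := unstraighten P N
  source := {T | IsUnit (pivot P N T)}
  target := {Z | IsUnit (corner P N Z + N)}
  map_source' T hT := by
    have := (unstraighten_straighten hP hN hPN hNP hs hT).1
    change IsUnit (corner P N (straighten P N T) + N)
    rw [this]
    exact hT
  map_target' Z hZ := (straighten_unstraighten hP hN hPN hNP hs hZ).1
  left_inv' T hT := (unstraighten_straighten hP hN hPN hNP hs hT).2
  right_inv' Z hZ := (straighten_unstraighten hP hN hPN hNP hs hZ).2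
  open_source := Units.isOpen.preimage (continuous_iff_continuousAt.2 fun T =>
    (analyticAt_pivot (𝕜 := 𝕜) T).continuousAt)
  open_target := Units.isOpen.preimage (continuous_iff_continuousAt.2 fun Z =>
    ((analyticAt_corner (𝕜 := 𝕜) Z).add analyticAt_const).continuousAt)
  continuousOn_toFun T hT := (analyticAt_straighten (𝕜 := 𝕜) hT).continuousAt.continuousWithinAt
  continuousOn_invFun Z _ := (analyticAt_unstraighten (𝕜 := 𝕜) Z).continuousAt.continuousWithinAt

variable (𝕜) in
/-- The elements whose diagonal blocks vanish. -/
def offDiagonal (P N : 𝔸) : Submodule 𝕜 𝔸 where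
  carrier := {Z | P * Z * P = 0 ∧ N * Z * N = 0}
  add_mem' := by
    rintro a b ⟨ha, ha'⟩ ⟨hb, hb'⟩
    exact ⟨by simp only [mul_add, add_mul, ha, hb, add_zero],
      by simp only [mul_add, add_mul, ha', hb', add_zero]⟩
  zero_mem' := by simp
  smul_mem' := by
    rintro c a ⟨ha, ha'⟩
    exact ⟨by simp [ha], by simp [ha']⟩

theorem closedComplemented_offDiagonal (hPN : P * N = 0)
    (hNP : N * P = 0) (hs : P + N = 1) : (offDiagonal 𝕜 P N).ClosedComplemented := by
  have h : ∀ Z : 𝔸, P * Z * N + N * Z * P ∈ offDiagonal 𝕜 P N := fun Z => by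
    constructor
    · simp only [mul_add, add_mul, mul_assoc, hNP, mul_zero, zero_add]
      simp only [← mul_assoc, hPN, zero_mul]
    · simp only [mul_add, add_mul, mul_assoc, hPN, mul_zero, add_zero]
      simp only [← mul_assoc, hNP, zero_mul]
  let π : 𝔸 →L[𝕜] 𝔸 :=
    ContinuousLinearMap.mul 𝕜 𝔸 P ∘L (ContinuousLinearMap.mul 𝕜 𝔸).flip N +
      ContinuousLinearMap.mul 𝕜 𝔸 N ∘L (ContinuousLinearMap.mul 𝕜 𝔸).flip P
  have hπ : ∀ Z, π Z = P * Z * N + N * Z * P := fun Z => by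
    simp [π, mul_assoc]
  refine ⟨π.codRestrict _ fun Z => by rw [hπ]; exact h Z, fun Z => Subtype.ext ?_⟩
  obtain ⟨Z, h1, h2⟩ := Z
  change π Z = Z
  have : Z = (P + N) * Z * (P + N) := by rw [hs, one_mul, mul_one]
  rw [hπ]
  conv_rhs => rw [this]
  simp only [mul_add, add_mul, h1, h2]
  abel

theorem exists_sliceChart [CompleteSpace 𝔸] (Q : {Q : 𝔸 | Q ≠ 0 ∧ Q ≠ 1 ∧ Q * Q = Q}) :
    ∃ c : SliceChart 𝕜 {Q : 𝔸 | Q ≠ 0 ∧ Q ≠ 1 ∧ Q * Q = Q}, (Q : 𝔸) ∈ c.toHomeo.source := by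
  obtain ⟨P, h0, h1, hP⟩ := Q
  have hN : (1 - P) * (1 - P) = 1 - P := by
    simp only [sub_mul, mul_sub, one_mul, mul_one, hP]; abel
  have hPN : P * (1 - P) = 0 := by rw [mul_sub, hP, mul_one, sub_self]
  have hNP : (1 - P) * P = 0 := by rw [sub_mul, hP, one_mul, sub_self]
  have hs : P + (1 - P) = 1 := by abel
  generalize 1 - P = N at *
  let e := straightenHomeo 𝕜 hP hN hPN hNP hs
  have hpiv : pivot P N P = 1 := by rw [pivot, hP, hP, hs]
  have hPe : P ∈ e.source := by
    change IsUnit (pivot P N P)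
    rw [hpiv]
    exact isUnit_one
  have hst : straighten P N P = 0 := by
    rw [straighten, lowerFactor, hP, hP, hNP, hPN]
    simp
  -- The norm bound is the smallness needed in `mul_self_iff_straighten`; removing 0 and 1 lets
  -- membership in the set reduce to the equation `T * T = T`.
  let U : Set 𝔸 := e.source ∩ e ⁻¹' {Z | ‖N * Z * N‖ < 1} ∩ ({0}ᶜ ∩ {1}ᶜ)
  have hU : IsOpen U := (e.isOpen_inter_preimage
    (isOpen_lt (by fun_prop) continuous_const)).inter
      (isOpen_compl_singleton.inter isOpen_compl_singleton)
  have hPU : P ∈ U := by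
    refine ⟨⟨hPe, ?_⟩, h0, h1⟩
    change ‖N * straighten P N P * N‖ < 1
    simp [hst]
  refine ⟨{
    pt := ⟨P, h0, h1, hP⟩
    toHomeo := e.restrOpen U hU
    slice := offDiagonal 𝕜 P N
    pt_mem := ⟨hPe, hPU⟩
    analytic := fun T hT => analyticAt_straighten hT.1
    analytic_symm := fun Z _ => analyticAt_unstraighten Z
    complemented := closedComplemented_offDiagonal hPN hNP hs
    mem_iff := ?_ }, hPe, hPU⟩
  rintro T ⟨hT, ⟨-, hT1⟩, hT2, hT3⟩
  have := mul_self_iff_straighten hP hN hPN hNP hs hT hT1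
  exact ⟨fun h => this.1 h.2.2, fun h => ⟨hT2, hT3, this.2 h⟩⟩

end IdempotentChart

/-! ### Projections along a fixed kernel. -/

section Projection

variable {𝕜 : Type u𝕜} [NontriviallyNormedField 𝕜] {X : Type uX} [NormedAddCommGroup X]
  [NormedSpace 𝕜 X]

theorem Submodule.IsTopCompl.projectionL_eq {E F : Submodule 𝕜 X} (h : Submodule.IsTopCompl E F)
    {x y : X} (hy : y ∈ E) (hxy : x - y ∈ F) : E.projectionL F h x = y := by
  have h1 := (Submodule.projectionL_apply_eq_zero_iff h).2 hxy
  rw [map_sub, sub_eq_zero] at h1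
  rw [h1, Submodule.projectionL_eq_self_iff h y]
  exact hy

theorem Submodule.IsTopCompl.sub_projectionL_mem {E F : Submodule 𝕜 X}
    (h : Submodule.IsTopCompl E F) (x : X) : x - E.projectionL F h x ∈ F := by
  rw [← Submodule.projectionL_eq_self_sub_projectionL]
  exact Submodule.projectionL_apply_mem _ _

/-- The projection onto the range of `j` along the kernel of `π`, if `π ∘ j` is invertible. -/
def rangeProjection {E G : Type*} [NormedAddCommGroup E] [NormedSpace 𝕜 E] [NormedAddCommGroup G]
    [NormedSpace 𝕜 G] (π : X →L[𝕜] E) (j : G →L[𝕜] X) : X →L[𝕜] X :=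
  j ∘L (π ∘L j).inverse ∘L π

variable {G : Type*} [NormedAddCommGroup G] [NormedSpace 𝕜 G]

/-- If `e = π ∘ j` is invertible, then `e⁻¹ ∘ π` is a left inverse of `j` with kernel `F`; a bounded
left inverse splits the space into the range of `j` and that kernel. -/
theorem isTopCompl_range_of_isInvertible {E F : Submodule 𝕜 X} (h : Submodule.IsTopCompl E F)
    {j : G →L[𝕜] X} (hj : (E.projectionOntoL F h ∘L j).IsInvertible) :
    ∃ hc : Submodule.IsTopCompl (LinearMap.range j.toLinearMap) F,
      Submodule.projectionL _ F hc = rangeProjection (E.projectionOntoL F h) j := by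
  obtain ⟨e, he⟩ := hj
  have he' : ∀ g, E.projectionOntoL F h (j g) = e g := fun g => by
    rw [← ContinuousLinearEquiv.coe_coe, he]; rfl
  have h1 := ContinuousLinearMap.isTopCompl_range_ker_of_leftInverse j
    (e.symm.toContinuousLinearMap ∘L E.projectionOntoL F h) (fun x => by simp [he'])
  have h2 : LinearMap.ker (e.symm.toContinuousLinearMap ∘L E.projectionOntoL F h).toLinearMap
      = F := by
    ext x
    simp
  rw [h2] at h1
  refine ⟨h1, ContinuousLinearMap.ext fun x => ?_⟩
  rw [rangeProjection, ← he, ContinuousLinearMap.inverse_equiv]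
  refine h1.projectionL_eq ⟨_, rfl⟩ ?_
  rw [← Submodule.projectionOntoL_apply_eq_zero_iff h, map_sub]
  simp [he']

/-- Converse of the preceding lemma. The inverse projects `E` onto the range of `j` along `F` and
then applies `k`; the left inverse `k` makes it bounded. -/
theorem isInvertible_of_isTopCompl_range {E F : Submodule 𝕜 X} (h : Submodule.IsTopCompl E F)
    {j : G →L[𝕜] X} (k : X →L[𝕜] G) (hk : ∀ g, k (j g) = g)
    (hc : Submodule.IsTopCompl (LinearMap.range j.toLinearMap) F) :
    (E.projectionOntoL F h ∘L j).IsInvertible := by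
  have hjk : ∀ x ∈ LinearMap.range j.toLinearMap, j (k x) = x := by
    rintro _ ⟨g, rfl⟩
    exact congrArg j (hk g)
  refine ContinuousLinearMap.IsInvertible.of_inverse
    (g := k ∘L Submodule.projectionL _ F hc ∘L E.subtypeL) ?_ ?_
  · ext x
    have h1 := hjk _ (Submodule.projectionL_apply_mem hc x)
    simp only [ContinuousLinearMap.comp_apply, Submodule.coe_projectionOntoL_apply,
      Submodule.subtypeL_apply, h1, ContinuousLinearMap.id_apply]
    refine h.projectionL_eq x.2 ?_
    rw [← Submodule.neg_mem_iff, neg_sub]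
    exact hc.sub_projectionL_mem _
  · ext g
    simp only [ContinuousLinearMap.comp_apply, Submodule.coe_projectionOntoL_apply,
      Submodule.subtypeL_apply, ContinuousLinearMap.id_apply]
    rw [hc.projectionL_eq (y := j g) ⟨g, rfl⟩, hk]
    rw [← Submodule.neg_mem_iff, neg_sub]
    exact h.sub_projectionL_mem _

theorem eventually_isInvertible_and_analyticAt_rangeProjection [CompleteSpace G]
    {E : Type*} [NormedAddCommGroup E] [NormedSpace 𝕜 E] [CompleteSpace E] [CompleteSpace X]
    {Z : Type*} [NormedAddCommGroup Z] [NormedSpace 𝕜 Z] {j : Z → G →L[𝕜] X} {z : Z}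
    (hj : AnalyticAt 𝕜 j z) {π : X →L[𝕜] E} (hi : (π ∘L j z).IsInvertible) :
    (∀ᶠ y in 𝓝 z, (π ∘L j y).IsInvertible) ∧
      AnalyticAt 𝕜 (fun y => rangeProjection π (j y)) z := by
  have h1 : AnalyticAt 𝕜 (fun y => π ∘L j y) z :=
    AnalyticAt.fun_comp (g := fun T => π ∘L T)
      ((ContinuousLinearMap.compL 𝕜 G X E π).analyticAt _) hj
  obtain ⟨e, he⟩ := hi
  refine ⟨?_, ?_⟩
  · have h2 : range ((↑) : (G ≃L[𝕜] E) → G →L[𝕜] E) ∈ 𝓝 (π ∘L j z) :=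
      ContinuousLinearEquiv.isOpen.mem_nhds ⟨e, he⟩
    exact h1.continuousAt.eventually h2
  -- The exponent `⊤` stands for analyticity, not merely for smoothness of infinite order.
  · have h2 : ContDiffAt 𝕜 ⊤ ContinuousLinearMap.inverse (π ∘L j z) := by
      rw [← he]
      exact contDiffAt_map_inverse e
    have h3 : ContDiffAt 𝕜 ⊤ (fun y => (π ∘L j y).inverse) z :=
      h2.comp (f := fun y => π ∘L j y) z h1.contDiffAt
    exact (hj.contDiffAt.clm_comp (h3.clm_comp contDiffAt_const)).analyticAt

end Projection

/-! ### The Grassmannian as a Hausdorff analytic manifold. -/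

namespace Grassmannian

variable {𝕜 : Type u𝕜} [RCLike 𝕜] {X : Type uX} [NormedAddCommGroup X] [NormedSpace 𝕜 X]

/-- The idempotent with range `E` and kernel `F` (and `0` if there is none). -/
def projAlong (F E : Grassmannian 𝕜 X) : X →L[𝕜] X := by
  classical exact if h : Compl E F then idem E F h else 0

theorem projAlong_eq {E F : Grassmannian 𝕜 X} (h : Compl E F) : projAlong F E = idem E F h := by
  simp [projAlong, h]

theorem mem_iff_projAlong_eq {E F : Grassmannian 𝕜 X} (h : Compl E F) {x : X} :
    x ∈ E.1 ↔ projAlong F E x = x := by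
  rw [projAlong_eq h]
  exact (Submodule.projectionL_eq_self_iff h x).symm

theorem projAlong_apply_mem {E F : Grassmannian 𝕜 X} (h : Compl E F) (x : X) :
    projAlong F E x ∈ E.1 := by
  rw [projAlong_eq h]
  exact Submodule.projectionL_apply_mem h x

theorem projAlong_apply_eq_zero_iff {E F : Grassmannian 𝕜 X} (h : Compl E F) {x : X} :
    projAlong F E x = 0 ↔ x ∈ F.1 := by
  rw [projAlong_eq h]
  exact Submodule.projectionL_apply_eq_zero_iff h

theorem sub_projAlong_mem {E F : Grassmannian 𝕜 X} (h : Compl E F) (x : X) :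
    x - projAlong F E x ∈ F.1 := by
  rw [projAlong_eq h]
  exact h.sub_projectionL_mem x

theorem projAlong_symm {E F : Grassmannian 𝕜 X} (h : Compl E F) :
    projAlong E F = 1 - projAlong F E := by
  rw [projAlong_eq h, projAlong_eq (E := F) (F := E) h.symm]
  exact Submodule.projectionL_eq_id_sub_projectionL h

/-- Projections along the same kernel. -/
theorem projAlong_mul {E E' F : Grassmannian 𝕜 X} (h : Compl E F) (h' : Compl E' F) :
    projAlong F E * projAlong F E' = projAlong F E := by
  ext x
  have h1 := (projAlong_apply_eq_zero_iff h).2 (sub_projAlong_mem h' x)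
  rw [map_sub, sub_eq_zero] at h1
  exact h1.symm

theorem exists_compl (E : Grassmannian 𝕜 X) : ∃ F, Compl E F := by
  obtain ⟨F, hF⟩ := Submodule.ClosedComplemented.exists_isTopCompl E.2.2.2
  exact ⟨⟨F, mem_of_isTopCompl hF.symm E.2.1 E.2.2.1⟩, hF⟩

/-- The linear map whose range is the graph of `T`. -/
def graphMap (p : ComplPair 𝕜 X) (T : p.E.1 →L[𝕜] p.F.1) : p.E.1 →L[𝕜] X :=
  p.E.1.subtypeL + p.F.1.subtypeL ∘L T

theorem projectionOntoL_graphMap (p : ComplPair 𝕜 X) (T : p.E.1 →L[𝕜] p.F.1) (x : p.E.1) :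
    p.E.1.projectionOntoL p.F.1 p.compl (graphMap p T x) = x := by
  have hp : Submodule.IsTopCompl p.E.1 p.F.1 := p.compl
  change p.E.1.projectionOntoL p.F.1 hp (graphMap p T x) = x
  simp [graphMap]

theorem analyticAt_graphMap (p : ComplPair 𝕜 X) (T : p.E.1 →L[𝕜] p.F.1) :
    AnalyticAt 𝕜 (graphMap p) T :=
  analyticAt_const.add ((ContinuousLinearMap.compL 𝕜 p.E.1 p.F.1 X p.F.1.subtypeL).analyticAt T)

/-- The graph point `x + T x` lies in `E` and differs from `x` by an element of `p.F`, so it is the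
projection of `x`. -/
theorem coe_chart_apply (p : ComplPair 𝕜 X) {E : Grassmannian 𝕜 X} (h : Compl E p.F)
    (x : p.E.1) : (chart p E x : X) = projAlong p.F E x - x := by
  have h' : Submodule.IsTopCompl E.1 p.F.1 := h
  have h1 : chart p E = -(p.F.1.projectionOntoL E.1 h'.symm ∘L p.E.1.subtypeL) := by
    simp [chart, h']
  have h2 : projAlong p.F E x = x - p.F.1.projectionL E.1 h'.symm x := by
    rw [projAlong_eq h]
    exact Submodule.projectionL_eq_self_sub_projectionL h'.symm (x : X)
  rw [h1, h2]
  simp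

/-- The chart of the Grassmannian in terms of projections. -/
def chartOfProj (p : ComplPair 𝕜 X) : (X →L[𝕜] X) →L[𝕜] p.E.1 →L[𝕜] p.F.1 :=
  ContinuousLinearMap.compL 𝕜 p.E.1 X p.F.1 (p.F.1.projectionOntoL p.E.1 p.compl.symm) ∘L
    (ContinuousLinearMap.compL 𝕜 p.E.1 X X).flip p.E.1.subtypeL

theorem chart_eq_chartOfProj (p : ComplPair 𝕜 X) {E : Grassmannian 𝕜 X} (h : Compl E p.F) :
    chart p E = chartOfProj p (projAlong p.F E) := by
  have hp : Submodule.IsTopCompl p.E.1 p.F.1 := p.compl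
  ext x
  have h2 : (chartOfProj p (projAlong p.F E) x : X) =
    p.F.1.projectionL p.E.1 hp.symm (projAlong p.F E x) := rfl
  rw [coe_chart_apply p h, h2]
  symm
  refine hp.symm.projectionL_eq ?_ ?_
  · rw [← Submodule.neg_mem_iff, neg_sub]
    exact sub_projAlong_mem h _
  · simp

/-- The projection along `p.F` in terms of the chart of the Grassmannian. -/
def projOfChart (p : ComplPair 𝕜 X) : (p.E.1 →L[𝕜] p.F.1) →L[𝕜] X →L[𝕜] X :=
  ContinuousLinearMap.compL 𝕜 X p.F.1 X p.F.1.subtypeL ∘L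
    (ContinuousLinearMap.compL 𝕜 X p.E.1 p.F.1).flip (p.E.1.projectionOntoL p.F.1 p.compl)

theorem projAlong_eq_projOfChart (p : ComplPair 𝕜 X) {E : Grassmannian 𝕜 X} (h : Compl E p.F) :
    projAlong p.F E = projAlong p.F p.E + projOfChart p (chart p E) := by
  have hp : Submodule.IsTopCompl p.E.1 p.F.1 := p.compl
  ext x
  have hx : (p.E.1.projectionOntoL p.F.1 hp x : X) = projAlong p.F p.E x := by
    rw [projAlong_eq p.compl]; rfl
  have h1 : (chart p E (p.E.1.projectionOntoL p.F.1 hp x) : X) =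
      projAlong p.F E (projAlong p.F p.E x) - projAlong p.F p.E x := by
    rw [coe_chart_apply p h, hx]
  have h2 : projAlong p.F E (projAlong p.F p.E x) = projAlong p.F E x :=
    DFunLike.congr_fun (projAlong_mul h p.compl) x
  change _ = projAlong p.F p.E x + (chart p E (p.E.1.projectionOntoL p.F.1 hp x) : X)
  rw [h1, h2]
  abel

variable [CompleteSpace X]

/-- The subspace with coordinate `T` is the range of `graphMap q T`, which is affine in `T` and has
the projection onto `q.E` as left inverse, so the invertibility criterion applies. -/
theorem eventually_chart_symm (p q : ComplPair 𝕜 X) {T : q.E.1 →L[𝕜] q.F.1}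
    (hT : (chart q).symm T ∈ compls p.F) :
    (∀ᶠ T' in 𝓝 T, (chart q).symm T' ∈ compls p.F) ∧
      AnalyticAt 𝕜 (fun T' => projAlong p.F ((chart q).symm T')) T := by
  have := q.E.completeSpace
  have := p.E.completeSpace
  have hi := isInvertible_of_isTopCompl_range p.compl
    (j := graphMap q T) (q.E.1.projectionOntoL q.F.1 q.compl) (projectionOntoL_graphMap q T) hT
  obtain ⟨h1, h2⟩ := eventually_isInvertible_and_analyticAt_rangeProjection
    (analyticAt_graphMap q T) hi
  have h3 : ∀ᶠ T' in 𝓝 T, (chart q).symm T' ∈ compls p.F ∧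
      rangeProjection (p.E.1.projectionOntoL p.F.1 p.compl) (graphMap q T') =
        projAlong p.F ((chart q).symm T') := by
    filter_upwards [h1] with T' hT'
    obtain ⟨hc, he⟩ := isTopCompl_range_of_isInvertible p.compl hT'
    refine ⟨hc, ?_⟩
    rw [projAlong_eq (E := (chart q).symm T') hc, ← he]
    rfl
  exact ⟨h3.mono fun _ h => h.1, h2.congr (h3.mono fun _ h => h.2)⟩

theorem isAnalyticAtlas : (grassmannCharts 𝕜 X).IsAnalyticAtlas := by
  refine ChartFamily.isAnalyticAtlas_topology ?_ ?_ ?_ ?_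
  · intro E
    obtain ⟨F, hF⟩ := E.exists_compl
    exact ⟨⟨E, F, hF⟩, hF⟩
  · exact fun _ => isOpen_univ
  · intro q p
    rw [isOpen_iff_mem_nhds]
    rintro T ⟨-, hT⟩
    filter_upwards [(eventually_chart_symm p q hT).1] with T' hT'
    exact ⟨trivial, hT'⟩
  · rintro q p T ⟨-, hT⟩
    obtain ⟨h1, h2⟩ := eventually_chart_symm p q hT
    refine (AnalyticAt.fun_comp ((chartOfProj p).analyticAt _) h2).congr ?_
    filter_upwards [h1] with T' hT'
    exact (chart_eq_chartOfProj p hT').symm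

theorem isOpen_compls {F : Grassmannian 𝕜 X} : IsOpen (compls F) := by
  obtain ⟨E, hE⟩ := F.exists_compl
  exact isAnalyticAtlas.isOpen_source (⟨E, F, hE.symm⟩ : ComplPair 𝕜 X)

theorem continuousAt_projAlong {E F : Grassmannian 𝕜 X} (h : Compl E F) :
    ContinuousAt (projAlong F) E := by
  let p : ComplPair 𝕜 X := ⟨E, F, h⟩
  have h1 : ContinuousAt (chart p) E :=
    isAnalyticAtlas.continuousAt (A := grassmannCharts 𝕜 X) (i := p) h
  have h2 : ContinuousAt (fun G => projAlong F E + projOfChart p (chart p G)) E :=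
    continuousAt_const.add ((projOfChart p).continuous.continuousAt.comp h1)
  refine h2.congr ?_
  filter_upwards [isOpen_compls.mem_nhds h] with G hG
  exact (projAlong_eq_projOfChart p hG).symm

/-- For `G` near both points, the projections onto `G` along `F` and `F'` have the same range, so
the second fixes the values of the first. In the limit the projection onto `E'` fixes `E`. By
symmetry, inseparable points coincide. -/
theorem le_of_neBot_nhds {E E' : Grassmannian 𝕜 X} (h : (𝓝 E ⊓ 𝓝 E').NeBot) : E.1 ≤ E'.1 := by
  obtain ⟨F, hF⟩ := E.exists_compl
  obtain ⟨F', hF'⟩ := E'.exists_compl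
  have h1 : Filter.Tendsto (projAlong F) (𝓝 E ⊓ 𝓝 E') (𝓝 (projAlong F E)) :=
    (continuousAt_projAlong hF).mono_left inf_le_left
  have h2 : Filter.Tendsto (projAlong F') (𝓝 E ⊓ 𝓝 E') (𝓝 (projAlong F' E')) :=
    (continuousAt_projAlong hF').mono_left inf_le_right
  have h3 : ∀ᶠ G in 𝓝 E ⊓ 𝓝 E', projAlong F G = projAlong F' G * projAlong F G := by
    filter_upwards [Filter.mem_inf_of_left (isOpen_compls.mem_nhds hF),
      Filter.mem_inf_of_right (isOpen_compls.mem_nhds hF')] with G hG hG'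
    ext x
    exact ((mem_iff_projAlong_eq hG').1 (projAlong_apply_mem hG x)).symm
  have h4 := tendsto_nhds_unique (h1.congr' h3) (h2.mul h1)
  intro x hx
  rw [mem_iff_projAlong_eq hF] at hx
  have h5 := DFunLike.congr_fun h4 x
  rw [mul_apply_eq_comp, hx] at h5
  exact (mem_iff_projAlong_eq hF').2 h5.symm

instance : T2Space (Grassmannian 𝕜 X) :=
  t2_iff_nhds.2 fun h =>
    Subtype.ext (le_antisymm (le_of_neBot_nhds h) (le_of_neBot_nhds (by rwa [inf_comm])))

end Grassmannian

theorem HasAnalyticExtensionAt.comp_analyticAt {𝕜 : Type u𝕜} [NontriviallyNormedField 𝕜]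
    {Y : Type uY} [NormedAddCommGroup Y] [NormedSpace 𝕜 Y] {S : Set Y}
    {Z : Type*} [NormedAddCommGroup Z] [NormedSpace 𝕜 Z] {h : S → Z}
    {E : Type*} [NormedAddCommGroup E] [NormedSpace 𝕜 E] {f : E → S} {t : E}
    (hh : HasAnalyticExtensionAt 𝕜 h (f t)) (hf : AnalyticAt 𝕜 (fun y => (f y : Y)) t) :
    AnalyticAt 𝕜 (fun y => h (f y)) t := by
  obtain ⟨g, hg, hhg⟩ := hh
  refine (AnalyticAt.fun_comp (g := g) (f := fun y => (f y : Y)) hg hf).congr ?_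
  have hc : ContinuousAt f t := IsInducing.subtypeVal.continuousAt_iff.2 hf.continuousAt
  filter_upwards [hc.eventually hhg] with y hy
  exact hy.symm

/-! ### Algebra of the coordinates `(R, S)`. -/

section BlockAlgebra

variable {A : Type*} [Ring A]

/-- The idempotent with given off-diagonal coordinates. -/
def blockIdempotent (P R S : A) : A := S - S * R + P + R * S - R * S * R + R

/-- Under these relations the element is `(1 + R)(P + S)(1 - R)`. The two middle identities say that
it shares its range with `π = P + R`, and they imply idempotency: `Q Q = Q (π Q) = (Q π) Q = π Q =
Q`. -/
theorem blockIdempotent_spec {P R S : A} (hP : P * P = P) (hPR : P * R = 0) (hRP : R * P = R)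
    (hPS : P * S = S) (hSP : S * P = 0) :
    blockIdempotent P R S * blockIdempotent P R S = blockIdempotent P R S ∧
    (P + R) * blockIdempotent P R S = blockIdempotent P R S ∧
    blockIdempotent P R S * (P + R) = P + R ∧
    P * blockIdempotent P R S * (1 - P) = S := by
  have hRR : R * R = 0 := by
    rw [← hRP, mul_assoc, ← mul_assoc P, hPR, zero_mul, mul_zero]
  have aux : ∀ {a b : A}, a * b = 0 → ∀ x, a * (b * x) = 0 := fun h x => by
    rw [← mul_assoc, h, zero_mul]
  have aux' : ∀ {a b c : A}, a * b = c → ∀ x, a * (b * x) = c * x := fun h x => by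
    rw [← mul_assoc, h]
  have h1 : (P + R) * blockIdempotent P R S = blockIdempotent P R S := by
    simp only [blockIdempotent, mul_add, mul_sub, add_mul, hP, hPR, hRP, hPS, hRR, aux' hPS,
      aux hPR, aux hRR, add_zero, sub_zero, mul_assoc]
    abel
  have h2 : blockIdempotent P R S * (P + R) = P + R := by
    simp only [blockIdempotent, mul_add, sub_mul, add_mul, hP, hPR, hRP, hSP, hRR, mul_zero,
      add_zero, sub_zero, mul_assoc]
    abel
  refine ⟨?_, h1, h2, ?_⟩
  · calc _ = blockIdempotent P R S * ((P + R) * blockIdempotent P R S) := by rw [h1]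
      _ = _ := by rw [← mul_assoc, h2, h1]
  · simp only [blockIdempotent, mul_add, mul_sub, sub_mul, add_mul, hP, hPR, hRP, hPS, hSP, mul_one,
      aux' hPS, aux hPR, add_zero, sub_zero, mul_assoc]
    abel

/-- Here `π` has the kernel of `P` and the range of `Q`; the four mixed product relations encode
exactly this. -/
theorem blockIdempotent_eq {P π Q : A} (hP : P * P = P) (hPπ : P * π = P) (hπP : π * P = π)
    (hπQ : π * Q = Q) (hQπ : Q * π = π) :
    blockIdempotent P (π - P) (P * Q * (1 - P)) = Q := by
  have aux' : ∀ {a b c : A}, a * b = c → ∀ x, a * (b * x) = c * x := fun h x => by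
    rw [← mul_assoc, h]
  have h1 : P * Q * (1 - P) * (π - P) = P - P * Q * P := by
    simp only [mul_sub, sub_mul, mul_one, mul_assoc, hPπ, hQπ, hP]
    abel
  have h2 : (π - P) * (P * Q * (1 - P)) = Q - Q * P - P * Q + P * Q * P := by
    simp only [mul_sub, sub_mul, mul_one, mul_assoc, aux' hπP, aux' hP, aux' hπQ, hπQ]
    abel
  rw [blockIdempotent, mul_assoc (π - P), h1, h2]
  simp only [mul_sub, sub_mul, mul_one, mul_assoc, aux' hπP, aux' hP, aux' hπQ, hP, hπP]
  abel

end BlockAlgebra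

/-! ### The map `κ` and the algebraic atlas. -/

section Idempotents

open Grassmannian

variable {𝕜 : Type u𝕜} [RCLike 𝕜] {X : Type uX} [NormedAddCommGroup X] [NormedSpace 𝕜 X]

theorem mem_rangeMap_iff {Q : idempotents 𝕜 X} {x : X} : x ∈ (rangeMap Q).1 ↔ Q.1 x = x := by
  refine ⟨?_, fun h => ⟨x, h⟩⟩
  rintro ⟨y, rfl⟩
  exact DFunLike.congr_fun Q.2.2.2 y

theorem apply_mem_rangeMap (Q : idempotents 𝕜 X) (x : X) : Q.1 x ∈ (rangeMap Q).1 := ⟨x, rfl⟩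

theorem projAlong_mul_idempotent {Q : idempotents 𝕜 X} {F : Grassmannian 𝕜 X}
    (h : Compl (rangeMap Q) F) : projAlong F (rangeMap Q) * Q.1 = Q.1 := by
  ext x
  exact (mem_iff_projAlong_eq h).1 (apply_mem_rangeMap Q x)

theorem idempotent_mul_projAlong {Q : idempotents 𝕜 X} {F : Grassmannian 𝕜 X}
    (h : Compl (rangeMap Q) F) : Q.1 * projAlong F (rangeMap Q) = projAlong F (rangeMap Q) := by
  ext x
  exact mem_rangeMap_iff.1 (projAlong_apply_mem h x)

theorem rangeMap_eq {Q : idempotents 𝕜 X} {E F : Grassmannian 𝕜 X} (h : Compl E F)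
    (h1 : projAlong F E * Q.1 = Q.1) (h2 : Q.1 * projAlong F E = projAlong F E) :
    rangeMap Q = E := by
  refine Subtype.ext (Submodule.ext fun x => ?_)
  rw [mem_rangeMap_iff, mem_iff_projAlong_eq h]
  constructor <;> intro hx
  · rw [← hx]
    exact DFunLike.congr_fun h1 x
  · rw [← hx]
    exact DFunLike.congr_fun h2 x

theorem projAlong_mem_idempotents {E F : Grassmannian 𝕜 X} (h : Compl E F) :
    projAlong F E ∈ idempotents 𝕜 X := by
  refine ⟨fun h0 => F.2.2.1 ?_, fun h1 => F.2.1 ?_, projAlong_mul h h⟩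
  · rw [eq_top_iff]
    intro x _
    rw [← projAlong_apply_eq_zero_iff h, h0]
    rfl
  · rw [eq_bot_iff]
    intro x hx
    rw [← projAlong_apply_eq_zero_iff h, h1] at hx
    exact hx

theorem mul_projAlong {E F : Grassmannian 𝕜 X} (h : Compl E F) {T : X →L[𝕜] X}
    (hT : ∀ x ∈ F.1, T x = 0) : T * projAlong F E = T := by
  ext x
  have h1 := hT _ (sub_projAlong_mem h x)
  rw [map_sub, sub_eq_zero] at h1
  exact h1.symm

/-- The first two relations give `π` the range of `Q`, the last two give it the kernel `F`; an
idempotent is determined by its range and kernel. -/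
theorem compl_rangeMap {Q : idempotents 𝕜 X} {E F : Grassmannian 𝕜 X} (h : Compl E F)
    {π : X →L[𝕜] X} (h1 : π * Q.1 = Q.1) (h2 : Q.1 * π = π) (h3 : projAlong F E * π = projAlong F E)
    (h4 : π * projAlong F E = π) :
    Compl (rangeMap Q) F ∧ projAlong F (rangeMap Q) = π := by
  have hi : IsIdempotentElem π := by
    change π * π = π
    calc π * π = π * projAlong F E * π := by rw [h4]
      _ = π := by rw [mul_assoc, h3, h4]
  have hc := ContinuousLinearMap.IsIdempotentElem.isTopCompl hi
  have hr : LinearMap.range π.toLinearMap = (rangeMap Q).1 := by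
    ext x
    rw [mem_rangeMap_iff]
    refine ⟨?_, fun hx => ⟨x, ?_⟩⟩
    · rintro ⟨y, rfl⟩
      exact DFunLike.congr_fun h2 y
    · have := DFunLike.congr_fun h1 x
      rwa [mul_apply_eq_comp, hx] at this
  have hk : LinearMap.ker π.toLinearMap = F.1 := by
    ext x
    rw [← projAlong_apply_eq_zero_iff h]
    refine ⟨fun hx => ?_, fun hx => ?_⟩
    · have h5 : π x = 0 := hx
      rw [← h3, mul_apply_eq_comp, h5, map_zero]
    · change π x = 0
      rw [← h4, mul_apply_eq_comp, hx, map_zero]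
  rw [hr, hk] at hc
  refine ⟨hc, ?_⟩
  ext x
  rw [projAlong_eq (show Compl (rangeMap Q) F from hc)]
  refine hc.projectionL_eq ?_ ?_
  · rw [← hr]
    exact ⟨x, rfl⟩
  · rw [← hk]
    change π (x - π x) = 0
    rw [map_sub, ← mul_apply_eq_comp, hi, sub_self]

theorem mem_nilpotentsAt_iff {E F : Grassmannian 𝕜 X} (h : Compl E F) {T : X →L[𝕜] X} :
    T ∈ nilpotentsAt F ↔ projAlong F E * T = 0 ∧ T * projAlong F E = T := by
  refine ⟨fun hT => ⟨?_, mul_projAlong h hT.2⟩, fun hT => ⟨fun x => ?_, fun x hx => ?_⟩⟩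
  · ext x
    exact (projAlong_apply_eq_zero_iff h).2 (hT.1 x)
  · exact (projAlong_apply_eq_zero_iff h).1 (DFunLike.congr_fun hT.1 x)
  · rw [← hT.2, mul_apply_eq_comp, (projAlong_apply_eq_zero_iff h).2 hx, map_zero]

theorem mem_nilpotentsAt_iff' {E F : Grassmannian 𝕜 X} (h : Compl E F) {T : X →L[𝕜] X} :
    T ∈ nilpotentsAt E ↔ projAlong F E * T = T ∧ T * projAlong F E = 0 := by
  rw [mem_nilpotentsAt_iff (E := F) (F := E) h.symm, projAlong_symm h, sub_mul, mul_sub, one_mul,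
    mul_one, sub_eq_zero, sub_eq_self, eq_comm]

/-- With `P` the projection onto a complement of `F` along `F`, the map `T ↦ (1 - P) T P` projects
onto the subspace. It transfers analyticity from `L(X)` to maps into the subspace. -/
theorem closedComplemented_nilpotentsAt (F : Grassmannian 𝕜 X) :
    (nilpotentsAt F).ClosedComplemented := by
  obtain ⟨E, hE⟩ := F.exists_compl
  have h : Compl E F := hE.symm
  let π : (X →L[𝕜] X) →L[𝕜] (X →L[𝕜] X) :=
    ContinuousLinearMap.mul 𝕜 (X →L[𝕜] X) (1 - projAlong F E) ∘L
      (ContinuousLinearMap.mul 𝕜 (X →L[𝕜] X)).flip (projAlong F E)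
  have hπ : ∀ T, π T = (1 - projAlong F E) * (T * projAlong F E) := fun T => rfl
  have hP : projAlong F E * projAlong F E = projAlong F E := projAlong_mul h h
  refine ⟨π.codRestrict _ fun T => ?_, fun T => Subtype.ext ?_⟩
  · rw [hπ, mem_nilpotentsAt_iff h, ← mul_assoc, mul_sub, mul_one, hP, sub_self, zero_mul,
      mul_assoc, mul_assoc, hP]
    exact ⟨rfl, rfl⟩
  · obtain ⟨h1, h2⟩ := (mem_nilpotentsAt_iff h).1 T.2
    change π T = T
    rw [hπ, h2, sub_mul, one_mul, h1, sub_zero]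

variable (p : ComplPair 𝕜 X)

theorem blockIdempotent_spec' (R : nilpotentsAt p.F) (S : nilpotentsAt p.E) :
    ∃ h : blockIdempotent (projAlong p.F p.E) R.1 S.1 ∈ idempotents 𝕜 X,
      Compl (rangeMap ⟨_, h⟩) p.F ∧
      projAlong p.F (rangeMap ⟨_, h⟩) = projAlong p.F p.E + R.1 ∧
      projAlong p.F p.E * blockIdempotent (projAlong p.F p.E) R.1 S.1 * (1 - projAlong p.F p.E) =
        S.1 := by
  obtain ⟨hR, hR'⟩ := (mem_nilpotentsAt_iff p.compl).1 R.2
  obtain ⟨hS, hS'⟩ := (mem_nilpotentsAt_iff' p.compl).1 S.2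
  have hmem := projAlong_mem_idempotents p.compl
  have hP : projAlong p.F p.E * projAlong p.F p.E = projAlong p.F p.E := hmem.2.2
  obtain ⟨h1, h2, h3, h4⟩ := blockIdempotent_spec hP hR hR' hS hS'
  have h5 : projAlong p.F p.E * (projAlong p.F p.E + R.1) = projAlong p.F p.E := by
    rw [mul_add, hP, hR, add_zero]
  have h6 : (projAlong p.F p.E + R.1) * projAlong p.F p.E = projAlong p.F p.E + R.1 := by
    rw [add_mul, hP, hR']
  have h : blockIdempotent (projAlong p.F p.E) R.1 S.1 ∈ idempotents 𝕜 X := by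
    refine ⟨fun h0 => hmem.1 ?_, fun h0 => hmem.2.1 ?_, h1⟩
    · rw [h0, zero_mul] at h3
      rw [← h5, ← h3, mul_zero]
    · rw [h0, mul_one] at h2
      rw [h2, one_mul] at h6
      exact h6
  obtain ⟨h7, h8⟩ := compl_rangeMap (Q := ⟨_, h⟩) p.compl h2 h3 h5 h6
  exact ⟨h, h7, h8, h4⟩

/-- The difference of the projections onto `E` and `p.E` along `p.F`. -/
def projDiff (E : Grassmannian 𝕜 X) : nilpotentsAt p.F := by
  classical exact if h : Compl E p.F then
    ⟨projAlong p.F E - projAlong p.F p.E, by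
      rw [mem_nilpotentsAt_iff p.compl, mul_sub, sub_mul, projAlong_mul p.compl h,
        projAlong_mul h p.compl, projAlong_mul p.compl p.compl]
      exact ⟨sub_self _, rfl⟩⟩ else 0

theorem coe_projDiff {E : Grassmannian 𝕜 X} (h : Compl E p.F) :
    (projDiff p E : X →L[𝕜] X) = projAlong p.F E - projAlong p.F p.E := by
  simp [projDiff, h]

/-- The coordinate of an idempotent that describes its position in the fiber. -/
def fiberCoord (Q : idempotents 𝕜 X) : nilpotentsAt p.E :=
  ⟨projAlong p.F p.E * Q * (1 - projAlong p.F p.E), by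
    have hP := projAlong_mul p.compl p.compl
    rw [mem_nilpotentsAt_iff' p.compl, ← mul_assoc, ← mul_assoc, hP, mul_assoc _ (1 - _),
      sub_mul, one_mul, hP, sub_self, mul_zero]
    exact ⟨rfl, rfl⟩⟩

/-- The idempotent with given coordinates. -/
def ofCoords (RS : nilpotentsAt p.F × nilpotentsAt p.E) : idempotents 𝕜 X :=
  ⟨blockIdempotent (projAlong p.F p.E) RS.1 RS.2, (blockIdempotent_spec' p RS.1 RS.2).1⟩

theorem compl_ofCoords (RS : nilpotentsAt p.F × nilpotentsAt p.E) :
    Compl (rangeMap (ofCoords p RS)) p.F := (blockIdempotent_spec' p RS.1 RS.2).2.1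

theorem projAlong_ofCoords (RS : nilpotentsAt p.F × nilpotentsAt p.E) :
    projAlong p.F (rangeMap (ofCoords p RS)) = projAlong p.F p.E + RS.1 :=
  (blockIdempotent_spec' p RS.1 RS.2).2.2.1

/-- The chart of the set of idempotents given by the off-diagonal coordinates. -/
def offDiagonalChart :
    PartialEquiv (idempotents 𝕜 X) (nilpotentsAt p.F × nilpotentsAt p.E) where
  toFun Q := (projDiff p (rangeMap Q), fiberCoord p Q)
  invFun := ofCoords p
  source := rangeMap ⁻¹' compls p.F
  target := univ
  map_source' _ _ := mem_univ _
  map_target' RS _ := compl_ofCoords p RS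
  left_inv' Q hQ := by
    have hc : Compl (rangeMap Q) p.F := hQ
    refine Subtype.ext ?_
    change blockIdempotent (projAlong p.F p.E) (projDiff p (rangeMap Q) : X →L[𝕜] X)
      (projAlong p.F p.E * Q * (1 - projAlong p.F p.E)) = Q
    rw [coe_projDiff p hc]
    exact blockIdempotent_eq (projAlong_mul p.compl p.compl) (projAlong_mul p.compl hc)
      (projAlong_mul hc p.compl) (projAlong_mul_idempotent hc) (idempotent_mul_projAlong hc)
  right_inv' RS _ := by
    refine Prod.ext (Subtype.ext ?_) (Subtype.ext ?_)
    · change (projDiff p (rangeMap (ofCoords p RS)) : X →L[𝕜] X) = RS.1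
      rw [coe_projDiff p (compl_ofCoords p RS), projAlong_ofCoords, add_sub_cancel_left]
    · exact (blockIdempotent_spec' p RS.1 RS.2).2.2.2

theorem analyticAt_ofCoords (RS : nilpotentsAt p.F × nilpotentsAt p.E) :
    AnalyticAt 𝕜 (fun RS => (ofCoords p RS : X →L[𝕜] X)) RS := by
  have h1 : AnalyticAt 𝕜 (fun RS : nilpotentsAt p.F × nilpotentsAt p.E => (RS.1 : X →L[𝕜] X)) RS :=
    AnalyticAt.fun_comp (f := Prod.fst) ((nilpotentsAt p.F).analyticAt_coe _) analyticAt_fst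
  have h2 : AnalyticAt 𝕜 (fun RS : nilpotentsAt p.F × nilpotentsAt p.E => (RS.2 : X →L[𝕜] X)) RS :=
    AnalyticAt.fun_comp (f := Prod.snd) ((nilpotentsAt p.E).analyticAt_coe _) analyticAt_snd
  unfold ofCoords blockIdempotent
  fun_prop

variable [CompleteSpace X]

/-- The element `u = Q Q₁ + (1 - Q)(1 - Q₁)` equals 1 at `Q = Q₁`, so it is invertible nearby. From
`Q u = Q Q₁` it follows that `Q` already attains its whole range on the range of `Q₁`. -/
theorem eventually_range_comp_subtypeL (Q₁ : idempotents 𝕜 X) :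
    ∀ᶠ Q : idempotents 𝕜 X in 𝓝 Q₁,
      LinearMap.range (Q.1 ∘L (rangeMap Q₁).1.subtypeL).toLinearMap = (rangeMap Q).1 := by
  have hQ₁ : Q₁.1 * Q₁.1 = Q₁.1 := Q₁.2.2.2
  have hc : Continuous fun Q : idempotents 𝕜 X => Q.1 * Q₁.1 + (1 - Q.1) * (1 - Q₁.1) := by
    fun_prop
  have h1 : Q₁.1 * Q₁.1 + (1 - Q₁.1) * (1 - Q₁.1) = 1 := by
    simp only [mul_sub, sub_mul, mul_one, one_mul, hQ₁]
    abel
  have h2 : ∀ᶠ Q : idempotents 𝕜 X in 𝓝 Q₁,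
      IsUnit (Q.1 * Q₁.1 + (1 - Q.1) * (1 - Q₁.1)) := by
    refine hc.continuousAt.eventually (Units.isOpen.mem_nhds ?_)
    change IsUnit (Q₁.1 * Q₁.1 + (1 - Q₁.1) * (1 - Q₁.1))
    rw [h1]
    exact isUnit_one
  filter_upwards [h2] with Q hQ
  obtain ⟨u, hu⟩ := hQ
  have hQQ : Q.1 * Q.1 = Q.1 := Q.2.2.2
  have h3 : Q.1 * (Q.1 * Q₁.1 + (1 - Q.1) * (1 - Q₁.1)) = Q.1 * Q₁.1 := by
    simp only [mul_sub, mul_add, sub_mul, mul_one, one_mul, ← mul_assoc, hQQ]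
    abel
  rw [← hu] at h3
  have h4 : Q.1 = Q.1 * Q₁.1 * ↑u⁻¹ := by
    rw [← h3, Units.mul_inv_cancel_right]
  refine le_antisymm ?_ ?_
  · rintro _ ⟨x, rfl⟩
    exact apply_mem_rangeMap Q _
  · rintro _ ⟨x, rfl⟩
    exact ⟨⟨Q₁.1 ((↑u⁻¹ : X →L[𝕜] X) x), apply_mem_rangeMap _ _⟩,
      (DFunLike.congr_fun h4 x).symm⟩

/-- Near `Q₁` the range of `Q` is that of `Q` restricted to the fixed space `rangeMap Q₁`. The
projection formula for this restriction makes sense for every operator near `Q₁`, idempotent or not,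
which provides the analytic extension. -/
theorem eventually_compl_and_hasAnalyticExtensionAt {Q₁ : idempotents 𝕜 X} {F : Grassmannian 𝕜 X}
    (h : Compl (rangeMap Q₁) F) :
    (∀ᶠ Q : idempotents 𝕜 X in 𝓝 Q₁, Compl (rangeMap Q) F) ∧
      HasAnalyticExtensionAt 𝕜 (fun Q : idempotents 𝕜 X => projAlong F (rangeMap Q)) Q₁ := by
  have := (rangeMap Q₁).completeSpace
  have ht : Submodule.IsTopCompl (rangeMap Q₁).1 F.1 := h
  let j : (X →L[𝕜] X) → (rangeMap Q₁).1 →L[𝕜] X := fun T => T ∘L (rangeMap Q₁).1.subtypeL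
  have hj : AnalyticAt 𝕜 j Q₁.1 :=
    ((ContinuousLinearMap.compL 𝕜 (rangeMap Q₁).1 X X).flip (rangeMap Q₁).1.subtypeL).analyticAt _
  have hi : ((rangeMap Q₁).1.projectionOntoL F.1 ht ∘L j Q₁.1).IsInvertible := by
    refine ⟨ContinuousLinearEquiv.refl 𝕜 _, ContinuousLinearMap.ext fun x => ?_⟩
    have hx : Q₁.1 x = x := mem_rangeMap_iff.1 x.2
    change x = (rangeMap Q₁).1.projectionOntoL F.1 ht (Q₁.1 x)
    rw [hx, Submodule.projectionOntoL_apply_left]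
  obtain ⟨h1, h2⟩ := eventually_isInvertible_and_analyticAt_rangeProjection hj hi
  have h3 : ∀ᶠ Q : idempotents 𝕜 X in 𝓝 Q₁, Compl (rangeMap Q) F ∧
      projAlong F (rangeMap Q) = rangeProjection ((rangeMap Q₁).1.projectionOntoL F.1 ht) (j Q) := by
    filter_upwards [continuous_subtype_val.continuousAt.eventually h1,
      eventually_range_comp_subtypeL Q₁] with Q hQ hr
    obtain ⟨hc, he⟩ := isTopCompl_range_of_isInvertible ht hQ
    have hc' : Compl (rangeMap Q) F := by
      change Submodule.IsTopCompl (rangeMap Q).1 F.1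
      rw [← hr]
      exact hc
    refine ⟨hc', ?_⟩
    rw [← he, projAlong_eq hc']
    unfold idem
    congr 1
    exact hr.symm
  exact ⟨h3.mono fun _ h => h.1, _, h2, h3.mono fun _ h => h.2⟩

theorem continuous_rangeMap : Continuous (rangeMap : idempotents 𝕜 X → Grassmannian 𝕜 X) := by
  rw [continuous_iff_continuousAt]
  intro Q
  obtain ⟨F, hF⟩ := (rangeMap Q).exists_compl
  let p : ComplPair 𝕜 X := ⟨rangeMap Q, F, hF⟩
  obtain ⟨h1, h2⟩ := eventually_compl_and_hasAnalyticExtensionAt hF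
  refine Grassmannian.isAnalyticAtlas.continuousAt_of_chart (B := grassmannCharts 𝕜 X) (j := p)
    h1 ?_
  refine ((chartOfProj p).continuous.continuousAt.comp h2.continuousAt).congr ?_
  filter_upwards [h1] with Q' hQ'
  exact (chart_eq_chartOfProj p hQ').symm

theorem hasAnalyticExtensionAt_chart_rangeMap {Q : idempotents 𝕜 X}
    (h : Compl (rangeMap Q) p.F) :
    HasAnalyticExtensionAt 𝕜 (fun Q : idempotents 𝕜 X => chart p (rangeMap Q)) Q := by
  obtain ⟨h1, h2⟩ := eventually_compl_and_hasAnalyticExtensionAt h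
  refine (h2.comp ((chartOfProj p).analyticAt _)).congr ?_
  filter_upwards [h1] with Q' hQ'
  exact chart_eq_chartOfProj p hQ'

theorem isAnalyticAtlas_submanifoldCharts_idempotents :
    (submanifoldCharts 𝕜 (idempotents 𝕜 X)).IsAnalyticAtlas :=
  isAnalyticAtlas_submanifoldCharts exists_sliceChart

theorem hasAnalyticExtensionAt_offDiagonalChart {Q : idempotents 𝕜 X}
    (h : Compl (rangeMap Q) p.F) : HasAnalyticExtensionAt 𝕜 (offDiagonalChart p) Q := by
  obtain ⟨h1, h2⟩ := eventually_compl_and_hasAnalyticExtensionAt h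
  refine HasAnalyticExtensionAt.prodMk (h := fun Q => projDiff p (rangeMap Q))
    (k := fiberCoord p) ?_ ?_
  · refine HasAnalyticExtensionAt.codRestrict (closedComplemented_nilpotentsAt p.F) ?_
    refine (h2.comp (g := fun T => T - projAlong p.F p.E)
      (analyticAt_id.sub analyticAt_const)).congr ?_
    filter_upwards [h1] with Q' hQ'
    exact coe_projDiff p hQ'
  · refine HasAnalyticExtensionAt.codRestrict (closedComplemented_nilpotentsAt p.E) ?_
    exact (HasAnalyticExtensionAt.coe Q).comp
      (g := fun T => projAlong p.F p.E * T * (1 - projAlong p.F p.E)) (by fun_prop)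

theorem isAnalyticAtlas_idempotentCharts :
    (idempotentCharts (𝕜 := 𝕜) (X := X) offDiagonalChart).IsAnalyticAtlas where
  covers Q := by
    obtain ⟨F, hF⟩ := (rangeMap Q).exists_compl
    exact ⟨⟨rangeMap Q, F, hF⟩, hF⟩
  isOpen_source p := isOpen_compls.preimage continuous_rangeMap
  isOpen_target _ := isOpen_univ
  continuousOn p Q hQ :=
    (hasAnalyticExtensionAt_offDiagonalChart p hQ).continuousAt.continuousWithinAt
  continuousOn_symm p RS _ := (IsInducing.subtypeVal.continuousAt_iff.2
    (analyticAt_ofCoords p RS).continuousAt).continuousWithinAt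
  analytic_transition p q := by
    rintro RS ⟨-, hRS⟩
    exact (hasAnalyticExtensionAt_offDiagonalChart q hRS).comp_analyticAt (analyticAt_ofCoords p RS)

theorem sameStructure_idempotentCharts :
    (idempotentCharts (𝕜 := 𝕜) (X := X) offDiagonalChart).SameStructure
      (submanifoldCharts 𝕜 (idempotents 𝕜 X)) :=
  ⟨isAnalyticOn_to_submanifold continuousOn_id fun _ _ p _ => analyticAt_ofCoords p _,
    isAnalyticOn_from_submanifold continuousOn_id fun _ _ p hp =>
      hasAnalyticExtensionAt_offDiagonalChart p hp⟩

end Idempotents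

theorem analyticAt_comp_mul_mul {𝕜 : Type u𝕜} [NontriviallyNormedField 𝕜] {𝔸 : Type uY}
    [NormedRing 𝔸] [NormedAlgebra 𝕜 𝔸] [CompleteSpace 𝔸] {Z V W : Type*}
    [NormedAddCommGroup Z] [NormedSpace 𝕜 Z] [NormedAddCommGroup V] [NormedSpace 𝕜 V]
    [NormedAddCommGroup W] [NormedSpace 𝕜 W] [CompleteSpace W] {g h : Z → 𝔸} {z : Z}
    (hg : AnalyticAt 𝕜 g z) (hh : AnalyticAt 𝕜 h z) (π : 𝔸 →L[𝕜] W) (j : V →L[𝕜] 𝔸) :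
    AnalyticAt 𝕜 (fun z => π ∘L ContinuousLinearMap.mul 𝕜 𝔸 (g z) ∘L
      (ContinuousLinearMap.mul 𝕜 𝔸).flip (h z) ∘L j) z := by
  have hg' := AnalyticAt.fun_comp ((ContinuousLinearMap.mul 𝕜 𝔸).analyticAt _) hg
  have hh' := AnalyticAt.fun_comp ((ContinuousLinearMap.mul 𝕜 𝔸).flip.analyticAt _) hh
  exact (contDiffAt_const.clm_comp (hg'.contDiffAt.clm_comp
    ((hh'.contDiffAt (n := ⊤)).clm_comp contDiffAt_const))).analyticAt

/-! ### The atlas of continuous affine maps. -/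

namespace AffineBanachSubspace

variable {𝕜 : Type u𝕜} [NontriviallyNormedField 𝕜] {Y : Type uY}
    [NormedAddCommGroup Y] [NormedSpace 𝕜 Y] {Z : Type uE}
    [NormedAddCommGroup Z] [NormedSpace 𝕜 Z] [CompleteSpace Z]

theorem isAnalyticAtlas_mapsCharts (A : AffineBanachSubspace 𝕜 Y)
    (B : AffineBanachSubspace 𝕜 Z) : (mapsCharts A B).IsAnalyticAtlas := by
  refine ChartFamily.isAnalyticAtlas_topology ?_ ?_ ?_ ?_
  · exact fun T => ⟨(Classical.arbitrary _, Classical.arbitrary _), trivial⟩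
  · exact fun _ => isOpen_univ
  · intro i j
    have : (((mapsCharts A B).chart i).symm.trans ((mapsCharts A B).chart j)).source = univ :=
      eq_univ_of_forall fun t => ⟨trivial, trivial⟩
    rw [this]
    exact isOpen_univ
  · rintro ⟨a, b⟩ ⟨a', b'⟩ t -
    have h : AnalyticAt 𝕜 (fun t : (A.space.direction →L[𝕜] B.space.direction) ×
        B.space.direction => (t.1, t.1 (a' -ᵥ a) + (t.2 + (b -ᵥ b')))) t := by
      have h1 : AnalyticAt 𝕜 (fun t : (A.space.direction →L[𝕜] B.space.direction) ×
          B.space.direction => t.1 (a' -ᵥ a)) t :=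
        (contDiffAt_fst.clm_apply (n := ⊤) contDiffAt_const).analyticAt
      have h2 : AnalyticAt 𝕜 (fun t : (A.space.direction →L[𝕜] B.space.direction) ×
          B.space.direction => t.2) t := analyticAt_snd
      exact analyticAt_fst.prod (h1.add (h2.add analyticAt_const))
    refine h.congr (Filter.Eventually.of_forall fun t => Prod.ext rfl ?_)
    change t.1 (a' -ᵥ a) + (t.2 + (b -ᵥ b')) = (t.1 (a' -ᵥ a) +ᵥ (t.2 +ᵥ b)) -ᵥ b'
    rw [vadd_vsub_assoc, vadd_vsub_assoc]

end AffineBanachSubspace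

/-! ### Fibers, trivializations and their transition maps. -/

section Bundle

open Grassmannian

variable {𝕜 : Type u𝕜} [RCLike 𝕜] {X : Type uX} [NormedAddCommGroup X] [NormedSpace 𝕜 X]

theorem projAlong_mul_projAlong {E F F' : Grassmannian 𝕜 X} (h : Compl E F) (h' : Compl E F') :
    projAlong F E * projAlong F' E = projAlong F' E := by
  ext x
  exact (mem_iff_projAlong_eq h).1 (projAlong_apply_mem h' x)

/-- A complementary pair whose first member is given. -/
def complPair (E : Grassmannian 𝕜 X) : ComplPair 𝕜 X := ⟨E, _, E.exists_compl.choose_spec⟩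

/-- The affine subspace of all idempotents with range `E`. -/
def idempotentFiber (E : Grassmannian 𝕜 X) : AffineBanachSubspace 𝕜 (X →L[𝕜] X) where
  space := AffineSubspace.mk' (projAlong (complPair E).F E) (nilpotentsAt E)
  nonempty := ⟨_, AffineSubspace.self_mem_mk' _ _⟩
  isClosed_direction := by
    rw [AffineSubspace.direction_mk']
    exact isClosed_nilpotentsAt E

theorem direction_idempotentFiber (E : Grassmannian 𝕜 X) :
    (idempotentFiber E).space.direction = nilpotentsAt E := AffineSubspace.direction_mk' _ _

theorem closedComplemented_direction (E : Grassmannian 𝕜 X) :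
    (idempotentFiber E).space.direction.ClosedComplemented := by
  rw [direction_idempotentFiber]
  exact closedComplemented_nilpotentsAt E

/-- The two equations say that `T` and the projection share the range `E`. They hold for every
complement `F`, so the fiber does not depend on the complement chosen to define it. -/
theorem mem_idempotentFiber_iff {E F : Grassmannian 𝕜 X} (h : Compl E F) {T : X →L[𝕜] X} :
    T ∈ (idempotentFiber E).space ↔
      projAlong F E * T = T ∧ T * projAlong F E = projAlong F E := by
  have hc : Compl E (complPair E).F := (complPair E).compl
  change T ∈ AffineSubspace.mk' _ _ ↔ _
  rw [AffineSubspace.mem_mk', vsub_eq_sub, mem_nilpotentsAt_iff' h, mul_sub, sub_mul,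
    projAlong_mul_projAlong h hc, projAlong_mul_projAlong hc h, sub_left_inj, sub_eq_zero]

theorem mem_idempotentFiber {Q : idempotents 𝕜 X} {E : Grassmannian 𝕜 X} (hE : rangeMap Q = E) :
    Q.1 ∈ (idempotentFiber E).space := by
  subst hE
  have h : Compl (rangeMap Q) (complPair (rangeMap Q)).F := (complPair (rangeMap Q)).compl
  rw [mem_idempotentFiber_iff h]
  exact ⟨projAlong_mul_idempotent h, idempotent_mul_projAlong h⟩

theorem mem_idempotents_of_mem_fiber {E : Grassmannian 𝕜 X} {T : X →L[𝕜] X}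
    (hT : T ∈ (idempotentFiber E).space) :
    ∃ h : T ∈ idempotents 𝕜 X, rangeMap ⟨T, h⟩ = E := by
  have h : Compl E (complPair E).F := (complPair E).compl
  have hm := projAlong_mem_idempotents h
  obtain ⟨h1, h2⟩ := (mem_idempotentFiber_iff h).1 hT
  have hT' : T ∈ idempotents 𝕜 X := by
    refine ⟨fun h0 => hm.1 ?_, fun h0 => hm.2.1 ?_, ?_⟩
    · rw [← h2, h0, zero_mul]
    · rw [h0, mul_one] at h1
      exact h1
    · calc T * T = T * projAlong (complPair E).F E * T := by rw [mul_assoc, h1]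
        _ = T := by rw [h2, h1]
  exact ⟨hT', rangeMap_eq h h1 h2⟩

/-- The identification of the fibers of `rangeMap` with affine subspaces. -/
def fiberHomeomorph (E : Grassmannian 𝕜 X) :
    (rangeMap ⁻¹' {E} : Set (idempotents 𝕜 X)) ≃ₜ (idempotentFiber E).space where
  toFun Q := ⟨Q.1.1, mem_idempotentFiber Q.2⟩
  invFun T := ⟨⟨T.1, (mem_idempotents_of_mem_fiber T.2).1⟩, (mem_idempotents_of_mem_fiber T.2).2⟩
  left_inv _ := rfl
  right_inv _ := rfl
  continuous_toFun := by fun_prop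
  continuous_invFun := by fun_prop

theorem surjective_rangeMap : Function.Surjective (rangeMap : idempotents 𝕜 X → _) := fun E =>
  ⟨_, (mem_idempotents_of_mem_fiber (Classical.arbitrary (idempotentFiber E).space).2).2⟩

variable (p : ComplPair 𝕜 X)

theorem projDiff_mul_self (E : Grassmannian 𝕜 X) :
    (projDiff p E : X →L[𝕜] X) * (projDiff p E : X →L[𝕜] X) = 0 := by
  ext x
  exact (projDiff p E).2.2 _ ((projDiff p E).2.1 x)

theorem one_add_mul_one_sub (E : Grassmannian 𝕜 X) :
    (1 + (projDiff p E : X →L[𝕜] X)) * (1 - projDiff p E) = 1 := by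
  simp only [mul_sub, add_mul, projDiff_mul_self, mul_one, one_mul, add_zero]
  abel

theorem one_sub_mul_one_add (E : Grassmannian 𝕜 X) :
    (1 - (projDiff p E : X →L[𝕜] X)) * (1 + projDiff p E) = 1 := by
  simp only [mul_add, sub_mul, projDiff_mul_self, mul_one, one_mul, sub_zero]
  abel

/-- `1 + projDiff p E` fixes `p.F` pointwise and sends `p.E` onto `E`, as projection along `p.F`
does; `1 - projDiff p E` is its inverse. -/
theorem projDiff_mul (E : Grassmannian 𝕜 X) (h : Compl E p.F) :
    (1 + (projDiff p E : X →L[𝕜] X)) * projAlong p.F p.E = projAlong p.F E ∧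
      (1 - (projDiff p E : X →L[𝕜] X)) * projAlong p.F E = projAlong p.F p.E ∧
      projAlong p.F E * (1 + projDiff p E) = projAlong p.F E ∧
      projAlong p.F p.E * (1 - projDiff p E) = projAlong p.F p.E := by
  rw [coe_projDiff p h]
  refine ⟨?_, ?_, ?_, ?_⟩ <;>
  simp only [mul_add, mul_sub, add_mul, sub_mul, one_mul, mul_one, projAlong_mul h p.compl,
    projAlong_mul p.compl h, projAlong_mul h h, projAlong_mul p.compl p.compl] <;> abel

theorem conj_mem_fiber {E : Grassmannian 𝕜 X} (h : Compl E p.F) {T : X →L[𝕜] X}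
    (hT : T ∈ (idempotentFiber p.E).space) :
    (1 + (projDiff p E : X →L[𝕜] X)) * T * (1 - projDiff p E) ∈ (idempotentFiber E).space := by
  obtain ⟨h1, h2⟩ := (mem_idempotentFiber_iff p.compl).1 hT
  obtain ⟨e1, e2, e3, e4⟩ := projDiff_mul p E h
  have h3 : (1 + (projDiff p E : X →L[𝕜] X)) * T = projAlong p.F E * T := by
    rw [← e1, mul_assoc, h1]
  rw [mem_idempotentFiber_iff h]
  constructor
  · rw [h3, ← mul_assoc, ← mul_assoc, projAlong_mul h h]
  · rw [mul_assoc, e2, mul_assoc, h2, e1]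

theorem conj_mem_fiber' {E : Grassmannian 𝕜 X} (h : Compl E p.F) {T : X →L[𝕜] X}
    (hT : T ∈ (idempotentFiber E).space) :
    (1 - (projDiff p E : X →L[𝕜] X)) * T * (1 + projDiff p E) ∈ (idempotentFiber p.E).space := by
  obtain ⟨h1, h2⟩ := (mem_idempotentFiber_iff h).1 hT
  obtain ⟨e1, e2, e3, e4⟩ := projDiff_mul p E h
  have h3 : (1 - (projDiff p E : X →L[𝕜] X)) * T = projAlong p.F p.E * T := by
    rw [← e2, mul_assoc, h1]
  rw [mem_idempotentFiber_iff p.compl]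
  constructor
  · rw [h3, ← mul_assoc, ← mul_assoc, projAlong_mul p.compl p.compl]
  · rw [mul_assoc, e1, mul_assoc, h2, e2]

/-- Conjugation of an idempotent with range `p.E` to one whose range is close to `E`. -/
def transport (Ex : Grassmannian 𝕜 X × (idempotentFiber p.E).space) : idempotents 𝕜 X :=
  ⟨(1 + (projDiff p Ex.1 : X →L[𝕜] X)) * Ex.2 * (1 - projDiff p Ex.1), by
    -- `projDiff` squares to zero also at its default value 0, so this is a conjugation for every
    -- `Ex.1`, complement of `p.F` or not, and it preserves idempotency and avoids 0 and 1.
    obtain ⟨hm, -⟩ := mem_idempotents_of_mem_fiber Ex.2.2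
    set T := (1 + (projDiff p Ex.1 : X →L[𝕜] X)) * Ex.2 * (1 - projDiff p Ex.1) with hT
    have h : (Ex.2 : X →L[𝕜] X) = (1 - projDiff p Ex.1) * T * (1 + projDiff p Ex.1) := by
      rw [hT, mul_assoc, mul_assoc, one_sub_mul_one_add, mul_one, ← mul_assoc,
        one_sub_mul_one_add, one_mul]
    refine ⟨fun h0 => hm.1 ?_, fun h0 => hm.2.1 ?_, ?_⟩
    · rw [h, h0, mul_zero, zero_mul]
    · rw [h, h0, mul_one, one_sub_mul_one_add]
    · calc T * T = (1 + (projDiff p Ex.1 : X →L[𝕜] X)) * Ex.2 *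
          ((1 - projDiff p Ex.1) * (1 + (projDiff p Ex.1 : X →L[𝕜] X))) * Ex.2 *
            (1 - projDiff p Ex.1) := by simp only [hT, mul_assoc]
        _ = (1 + (projDiff p Ex.1 : X →L[𝕜] X)) * ((Ex.2 : X →L[𝕜] X) * Ex.2) *
            (1 - projDiff p Ex.1) := by
          rw [one_sub_mul_one_add, mul_one]; simp only [mul_assoc]
        _ = T := by rw [hm.2.2]⟩

theorem rangeMap_transport {E : Grassmannian 𝕜 X} (h : Compl E p.F)
    (x : (idempotentFiber p.E).space) : rangeMap (transport p (E, x)) = E :=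
  (mem_idempotents_of_mem_fiber (conj_mem_fiber p h x.2)).2

/-- Conjugation of an idempotent to one with range `p.E`. -/
def transportBack (Q : idempotents 𝕜 X) : (idempotentFiber p.E).space := by
  classical exact if h : Compl (rangeMap Q) p.F then
    ⟨(1 - (projDiff p (rangeMap Q) : X →L[𝕜] X)) * Q * (1 + projDiff p (rangeMap Q)),
      conj_mem_fiber' p h (mem_idempotentFiber rfl)⟩
  else Classical.arbitrary _

theorem coe_transportBack {Q : idempotents 𝕜 X} (h : Compl (rangeMap Q) p.F) :
    (transportBack p Q : X →L[𝕜] X) =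
      (1 - (projDiff p (rangeMap Q) : X →L[𝕜] X)) * Q * (1 + projDiff p (rangeMap Q)) := by
  simp [transportBack, h]

/-- The local trivialization of the bundle of idempotents. -/
def trivialization :
    PartialEquiv (Grassmannian 𝕜 X × (idempotentFiber p.E).space) (idempotents 𝕜 X) where
  toFun := transport p
  invFun Q := (rangeMap Q, transportBack p Q)
  source := compls p.F ×ˢ univ
  target := rangeMap ⁻¹' compls p.F
  map_source' := by
    rintro ⟨E, x⟩ ⟨h, -⟩
    change rangeMap (transport p (E, x)) ∈ compls p.F
    rw [rangeMap_transport p h]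
    exact h
  map_target' Q hQ := ⟨hQ, trivial⟩
  left_inv' := by
    rintro ⟨E, x⟩ ⟨h, -⟩
    have h1 := rangeMap_transport p h x
    refine Prod.ext h1 (Subtype.ext ?_)
    rw [coe_transportBack p (by rwa [h1]), h1, transport, mul_assoc, mul_assoc,
      one_sub_mul_one_add, mul_one, ← mul_assoc, one_sub_mul_one_add, one_mul]
  right_inv' Q hQ := by
    refine Subtype.ext ?_
    change (1 + (projDiff p (rangeMap Q) : X →L[𝕜] X)) * transportBack p Q *
      (1 - projDiff p (rangeMap Q)) = Q
    rw [coe_transportBack p hQ, mul_assoc, mul_assoc,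
      one_add_mul_one_sub, mul_one, ← mul_assoc, one_add_mul_one_sub, one_mul]

/-- The continuous affine map `x ↦ G * x * H` between fibers. -/
def fiberConj {E E' : Grassmannian 𝕜 X} (G H : X →L[𝕜] X)
    (hm : ∀ x ∈ (idempotentFiber E).space, G * x * H ∈ (idempotentFiber E').space) :
    (idempotentFiber E).space →ᴬ[𝕜] (idempotentFiber E').space where
  toAffineMap := AffineMap.restrict
    (ContinuousLinearMap.mul 𝕜 (X →L[𝕜] X) G ∘L
      (ContinuousLinearMap.mul 𝕜 (X →L[𝕜] X)).flip H).toLinearMap.toAffineMap (by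
        rintro _ ⟨x, hx, rfl⟩
        have := hm x hx
        rwa [mul_assoc] at this)
  cont := by
    refine Continuous.subtype_mk (f := fun x : (idempotentFiber E).space => G * (x.1 * H)) ?_ _
    fun_prop

theorem coe_fiberConj {E E' : Grassmannian 𝕜 X} (G H : X →L[𝕜] X)
    (hm : ∀ x ∈ (idempotentFiber E).space, G * x * H ∈ (idempotentFiber E').space)
    (x : (idempotentFiber E).space) : (fiberConj G H hm x : X →L[𝕜] X) = G * x * H :=
  (mul_assoc G x.1 H).symm

theorem coe_contLinear_fiberConj {E E' : Grassmannian 𝕜 X} (G H : X →L[𝕜] X)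
    (hm : ∀ x ∈ (idempotentFiber E).space, G * x * H ∈ (idempotentFiber E').space)
    (d : (idempotentFiber E).space.direction) :
    ((fiberConj G H hm).contLinear d : X →L[𝕜] X) = G * d * H :=
  (mul_assoc G d.1 H).symm

/-- The transition map between two local trivializations. -/
def fiberTransition (p q : ComplPair 𝕜 X) (E : Grassmannian 𝕜 X) :
    (idempotentFiber p.E).space →ᴬ[𝕜] (idempotentFiber q.E).space := by
  classical exact if h : Compl E p.F ∧ Compl E q.F then
    (fiberConj ((1 - (projDiff q E : X →L[𝕜] X)) * (1 + (projDiff p E : X →L[𝕜] X)))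
      ((1 - (projDiff p E : X →L[𝕜] X)) * (1 + (projDiff q E : X →L[𝕜] X))) (fun x hx => by
        have := conj_mem_fiber' q h.2 (conj_mem_fiber p h.1 hx)
        simpa only [mul_assoc] using this))
  else ContinuousAffineMap.const 𝕜 _ (Classical.arbitrary _)

theorem coe_fiberTransition {p q : ComplPair 𝕜 X} {E : Grassmannian 𝕜 X} (hp : Compl E p.F)
    (hq : Compl E q.F) (x : (idempotentFiber p.E).space) :
    (fiberTransition p q E x : X →L[𝕜] X) =
      ((1 - (projDiff q E : X →L[𝕜] X)) * (1 + projDiff p E)) * x *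
        ((1 - projDiff p E) * (1 + projDiff q E)) := by
  simp only [fiberTransition, hp, hq, and_self, dite_true, coe_fiberConj]

theorem coe_contLinear_fiberTransition {p q : ComplPair 𝕜 X} {E : Grassmannian 𝕜 X}
    (hp : Compl E p.F) (hq : Compl E q.F) (d : (idempotentFiber p.E).space.direction) :
    ((fiberTransition p q E).contLinear d : X →L[𝕜] X) =
      ((1 - (projDiff q E : X →L[𝕜] X)) * (1 + projDiff p E)) * d *
        ((1 - projDiff p E) * (1 + projDiff q E)) := by
  simp only [fiberTransition, hp, hq, and_self, dite_true, coe_contLinear_fiberConj]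

theorem fiberTransition_eq {p q : ComplPair 𝕜 X} {E : Grassmannian 𝕜 X} (hp : Compl E p.F)
    (hq : Compl E q.F) (x : (idempotentFiber p.E).space) :
    fiberTransition p q E x = ((trivialization q).symm (trivialization p (E, x))).2 := by
  have h := rangeMap_transport p hp x
  refine Subtype.ext ?_
  change _ = (transportBack q (transport p (E, x)) : X →L[𝕜] X)
  rw [coe_fiberTransition hp hq, coe_transportBack q (by rwa [h]), h]
  simp only [transport, mul_assoc]

variable [CompleteSpace X]

theorem continuousAt_projDiff {E : Grassmannian 𝕜 X} (h : Compl E p.F) :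
    ContinuousAt (fun E => (projDiff p E : X →L[𝕜] X)) E := by
  refine ((continuousAt_projAlong h).sub (continuousAt_const (y := projAlong p.F p.E))).congr ?_
  filter_upwards [isOpen_compls.mem_nhds h] with G hG
  exact (coe_projDiff p hG).symm

theorem analyticAt_projDiff (q : ComplPair 𝕜 X) {T : q.E.1 →L[𝕜] q.F.1}
    (hT : (chart q).symm T ∈ compls p.F) :
    AnalyticAt 𝕜 (fun T => (projDiff p ((chart q).symm T) : X →L[𝕜] X)) T := by
  obtain ⟨h1, h2⟩ := eventually_chart_symm p q hT
  refine (h2.sub (analyticAt_const (v := projAlong p.F p.E))).congr ?_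
  filter_upwards [h1] with T' hT'
  exact (coe_projDiff p hT').symm

theorem hasAnalyticExtensionAt_transportBack {Q : idempotents 𝕜 X} (h : Compl (rangeMap Q) p.F) :
    HasAnalyticExtensionAt 𝕜 (fun Q => (transportBack p Q : X →L[𝕜] X)) Q := by
  obtain ⟨h1, h2⟩ := eventually_compl_and_hasAnalyticExtensionAt h
  have hg : ∀ z : (X →L[𝕜] X) × (X →L[𝕜] X), AnalyticAt 𝕜 (fun z : (X →L[𝕜] X) × (X →L[𝕜] X) =>
      (1 - (z.2 - projAlong p.F p.E)) * z.1 * (1 + (z.2 - projAlong p.F p.E))) z := fun z =>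
    ((analyticAt_const.sub (analyticAt_snd.sub analyticAt_const)).mul analyticAt_fst).mul
      (analyticAt_const.add (analyticAt_snd.sub analyticAt_const))
  refine (((HasAnalyticExtensionAt.coe Q).prodMk h2).comp (hg _)).congr ?_
  filter_upwards [h1] with Q' hQ'
  rw [coe_transportBack p hQ', coe_projDiff p hQ']

theorem isAnalyticOn_trivialization :
    ((grassmannCharts 𝕜 X).prod (idempotentFiber p.E).charts).IsAnalyticOn
      (submanifoldCharts 𝕜 (idempotents 𝕜 X)) (trivialization p) (trivialization p).source := by
  refine isAnalyticOn_to_submanifold ?_ ?_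
  · rintro ⟨E, x⟩ ⟨h, -⟩
    refine (IsInducing.subtypeVal.continuousAt_iff.2 ?_).continuousWithinAt
    have h1 : ContinuousAt (fun Ex : Grassmannian 𝕜 X × (idempotentFiber p.E).space =>
        (projDiff p Ex.1 : X →L[𝕜] X)) (E, x) :=
      ContinuousAt.comp (f := Prod.fst) (continuousAt_projDiff p h) continuousAt_fst
    have h2 : Continuous (fun Ex : Grassmannian 𝕜 X × (idempotentFiber p.E).space =>
        (Ex.2 : X →L[𝕜] X)) := by fun_prop
    exact ((continuousAt_const.add h1).mul h2.continuousAt).mul (continuousAt_const.sub h1)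
  · rintro ⟨E, x⟩ ⟨h, -⟩ ⟨q, (a : (idempotentFiber p.E).space)⟩ ⟨hq, -⟩
    have hl : (chart q).symm (chart q E) = E := (chart q).left_inv hq
    have h1 := analyticAt_projDiff p q (T := chart q E) (by rwa [hl])
    let t : (q.E.1 →L[𝕜] q.F.1) × (idempotentFiber p.E).space.direction :=
      (chart q E, x -ᵥ a)
    have h2 : AnalyticAt 𝕜 (fun z : (q.E.1 →L[𝕜] q.F.1) × (idempotentFiber p.E).space.direction =>
        (projDiff p ((chart q).symm z.1) : X →L[𝕜] X)) t :=
      AnalyticAt.fun_comp (f := Prod.fst)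
        (g := fun T => (projDiff p ((chart q).symm T) : X →L[𝕜] X)) h1 analyticAt_fst
    have h3 : AnalyticAt 𝕜 (fun z : (q.E.1 →L[𝕜] q.F.1) × (idempotentFiber p.E).space.direction =>
        (z.2 : X →L[𝕜] X) + a.1) t :=
      (AnalyticAt.fun_comp (f := Prod.snd)
        ((idempotentFiber p.E).space.direction.analyticAt_coe _) analyticAt_snd).add analyticAt_const
    exact ((analyticAt_const.add h2).mul h3).mul (analyticAt_const.sub h2)

theorem isAnalyticOn_trivialization_symm :
    (submanifoldCharts 𝕜 (idempotents 𝕜 X)).IsAnalyticOn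
      ((grassmannCharts 𝕜 X).prod (idempotentFiber p.E).charts) (trivialization p).symm
      (trivialization p).target := by
  refine isAnalyticOn_from_submanifold ?_ ?_
  · intro Q hQ
    exact (continuous_rangeMap.continuousAt.prodMk (IsInducing.subtypeVal.continuousAt_iff.2
      (hasAnalyticExtensionAt_transportBack p hQ).continuousAt)).continuousWithinAt
  · rintro Q hQ ⟨q, (a : (idempotentFiber p.E).space)⟩ ⟨hq, -⟩
    refine HasAnalyticExtensionAt.prodMk (h := fun Q => chart q (rangeMap Q))
      (k := fun Q => transportBack p Q -ᵥ a) (hasAnalyticExtensionAt_chart_rangeMap q hq) ?_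
    refine HasAnalyticExtensionAt.codRestrict (closedComplemented_direction p.E) ?_
    exact (hasAnalyticExtensionAt_transportBack p hQ).comp (g := fun T => T - a.1)
      (analyticAt_id.sub (analyticAt_const (v := a.1)))

theorem isAnalyticOn_rangeMap : (submanifoldCharts 𝕜 (idempotents 𝕜 X)).IsAnalyticOn
    (grassmannCharts 𝕜 X) rangeMap univ :=
  isAnalyticOn_from_submanifold continuous_rangeMap.continuousOn fun _ _ q hq =>
    hasAnalyticExtensionAt_chart_rangeMap q hq

theorem isAnalyticOn_fiberTransition (p q : ComplPair 𝕜 X) :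
    (grassmannCharts 𝕜 X).IsAnalyticOn
      (AffineBanachSubspace.mapsCharts (idempotentFiber p.E) (idempotentFiber q.E))
      (fiberTransition p q) (compls p.F ∩ compls q.F) := by
  refine Grassmannian.isAnalyticAtlas.isAnalyticOn
    (AffineBanachSubspace.isAnalyticAtlas_mapsCharts _ _) ?_
  rintro E ⟨hp, hq⟩ r ⟨a, b⟩ hr -
  -- The charts on the space of affine maps are global, so no neighborhood condition arises.
  refine ⟨Filter.Eventually.of_forall fun _ => trivial, ?_⟩
  have hl : (chart r).symm (chart r E) = E := (chart r).left_inv hr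
  have hp' := analyticAt_projDiff p r (T := chart r E) (by rwa [hl])
  have hq' := analyticAt_projDiff q r (T := chart r E) (by rwa [hl])
  have h1 := (eventually_chart_symm p r (T := chart r E) (by rwa [hl])).1
  have h2 := (eventually_chart_symm q r (T := chart r E) (by rwa [hl])).1
  have h1' : AnalyticAt 𝕜 (fun _ : r.E.1 →L[𝕜] r.F.1 => (1 : X →L[𝕜] X)) (chart r E) :=
    analyticAt_const
  have hG := (h1'.sub hq').mul (h1'.add hp')
  have hH := (h1'.sub hp').mul (h1'.add hq')
  refine AnalyticAt.prod
    (f := fun T => (fiberTransition p q ((chart r).symm T)).contLinear)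
    (g := fun T => fiberTransition p q ((chart r).symm T) a -ᵥ b) ?_ ?_
  · obtain ⟨π, hπ⟩ := closedComplemented_direction q.E
    -- The linear part is `d ↦ G d H`, with `G` and `H` analytic in the chart; `π` retracts onto the
    -- direction of the target fiber, and composition is bilinear in the operator norm.
    refine (analyticAt_comp_mul_mul hG hH π
      (idempotentFiber p.E).space.direction.subtypeL).congr ?_
    filter_upwards [h1, h2] with T hT1 hT2
    ext1 d
    rw [← hπ ((fiberTransition p q ((chart r).symm T)).contLinear d),
      coe_contLinear_fiberTransition hT1 hT2, mul_assoc]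
    rfl
  · refine Submodule.ClosedComplemented.analyticAt (closedComplemented_direction q.E) ?_
    refine (((hG.mul (analyticAt_const (v := (a : X →L[𝕜] X)))).mul hH).sub
      (analyticAt_const (v := (b : X →L[𝕜] X)))).congr ?_
    filter_upwards [h1, h2] with T hT1 hT2
    change _ = (fiberTransition p q ((chart r).symm T) a : X →L[𝕜] X) - b
    rw [coe_fiberTransition hT1 hT2]
    rfl

theorem isAnalyticAffineBanachBundle_rangeMap :
    IsAnalyticAffineBanachBundle (submanifoldCharts 𝕜 (idempotents 𝕜 X)) (grassmannCharts 𝕜 X)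
      rangeMap idempotentFiber fiberHomeomorph where
  t2_total := inferInstance
  t2_base := inferInstance
  total_atlas := isAnalyticAtlas_submanifoldCharts_idempotents
  base_atlas := Grassmannian.isAnalyticAtlas
  continuous_proj := continuous_rangeMap
  surjective_proj := surjective_rangeMap
  analytic_proj := isAnalyticOn_rangeMap
  locally_trivial := by
    refine ⟨fun E => compls (complPair E).F, fun E => trivialization (complPair E), fun E₀ => ?_,
      fun E₁ E₂ _ => ⟨fiberTransition (complPair E₁) (complPair E₂), ?_, ?_⟩⟩
    · refine ⟨isOpen_compls, (complPair E₀).compl, rfl, rfl,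
        isAnalyticOn_trivialization (complPair E₀), isAnalyticOn_trivialization_symm (complPair E₀),
        fun E hE => ⟨(fiberConj _ _ fun x hx => conj_mem_fiber (complPair E₀) hE hx).toAffineMap,
          fun y => ?_, fun x => ?_⟩⟩
      -- The preimage of `y` is its conjugate by the inverse element `1 - R`.
      · refine ⟨⟨_, conj_mem_fiber' (complPair E₀) hE y.2⟩, Subtype.ext ?_⟩
        refine (coe_fiberConj _ _ (fun x hx => conj_mem_fiber (complPair E₀) hE hx) _).trans ?_
        rw [mul_assoc, mul_assoc, one_add_mul_one_sub, mul_one, ← mul_assoc, one_add_mul_one_sub,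
          one_mul]
      · refine Subtype.ext ?_
        exact (coe_fiberConj _ _ (fun x hx => conj_mem_fiber (complPair E₀) hE hx) x).symm
    · rintro E ⟨h1, h2⟩ x
      exact fiberTransition_eq h1 h2 x
    · exact isAnalyticOn_fiberTransition (complPair E₁) (complPair E₂)

end Bundle

end

theorem theorem3 {𝕜 : Type*} [RCLike 𝕜] {X : Type*} [NormedAddCommGroup X] [NormedSpace 𝕜 X]
    [CompleteSpace X] :
    -- `κ` is a locally trivial analytic affine-Banach bundle, for the submanifold structure on the
    -- idempotents and the affine-Banach structures on the fibers that are induced from `L(X)`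
    (∃ (fib : Grassmannian 𝕜 X → AffineBanachSubspace 𝕜 (X →L[𝕜] X))
      (e : ∀ E, (rangeMap ⁻¹' {E} : Set (idempotents 𝕜 X)) ≃ₜ (fib E).space),
      (∀ E Q, (e E Q : X →L[𝕜] X) = Q) ∧
      IsAnalyticAffineBanachBundle (submanifoldCharts 𝕜 (idempotents 𝕜 X))
        (grassmannCharts 𝕜 X) rangeMap fib e) ∧
    -- the algebraic atlas of the idempotents
    (∃ μ : ∀ p : ComplPair 𝕜 X,
        PartialEquiv (idempotents 𝕜 X) (nilpotentsAt p.F × nilpotentsAt p.E),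
      (∀ p, (μ p).source = rangeMap ⁻¹' Grassmannian.compls p.F ∧ (μ p).target = univ ∧
        (∀ (Q : idempotents 𝕜 X) (h : Grassmannian.Compl (rangeMap Q) p.F),
          ((μ p Q).1 : X →L[𝕜] X) =
              Grassmannian.idem (rangeMap Q) p.F h - Grassmannian.idem p.E p.F p.compl ∧
            ((μ p Q).2 : X →L[𝕜] X) =
              Grassmannian.idem p.E p.F p.compl * Q * Grassmannian.idem p.F p.E p.compl.symm) ∧
        ∀ (R : nilpotentsAt p.F) (S : nilpotentsAt p.E),
          (((μ p).symm (R, S) : idempotents 𝕜 X) : X →L[𝕜] X) =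
            S - S * R + Grassmannian.idem p.E p.F p.compl + R * S - R * S * R + R) ∧
      (idempotentCharts μ).IsAnalyticAtlas ∧
      (idempotentCharts μ).SameStructure (submanifoldCharts 𝕜 (idempotents 𝕜 X))) := by
  refine ⟨⟨idempotentFiber, fiberHomeomorph, fun _ _ => rfl,
    isAnalyticAffineBanachBundle_rangeMap⟩, offDiagonalChart, fun p => ⟨rfl, rfl, fun Q h => ?_,
      fun R S => ?_⟩, isAnalyticAtlas_idempotentCharts, sameStructure_idempotentCharts⟩
  · refine ⟨?_, ?_⟩
    · rw [← Grassmannian.projAlong_eq h, ← Grassmannian.projAlong_eq p.compl]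
      exact coe_projDiff p h
    · rw [← Grassmannian.projAlong_eq p.compl,
        ← Grassmannian.projAlong_eq (E := p.F) (F := p.E) p.compl.symm,
        Grassmannian.projAlong_symm p.compl]
      rfl
  · rw [← Grassmannian.projAlong_eq p.compl]
    rfl
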